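/- Conventions. All spaces carry the Euclidean norm. A function $f:\mathbb{R}^n\to[-\infty,\infty]$ is proper if it never equals $-\infty$ and $\operatorname{dom} f=\{x: f(x)<\infty\}\neq\emptyset$, closed if it is lower semicontinuous, and polyhedral if its epigraph is a polyhedron (the solution set of finitely many affine inequalities). For $x\in\operatorname{dom} f$, the regular subdifferential is $\widehat\partial f(x)=\{v:\ \liminf_{z\to x,\,z\ne x}\frac{f(z)-f(x)-\langle v,z-x\rangle}{\|z-x\|}\ge 0\}$, and the (limiting) subdifferential $\partial f(x)$ is the set of all $v$ for which there are $x^t\to x$ with $f(x^t)\to f(x)$ and $v^t\in\widehat\partial f(x^t)$ with $v^t\to v$; both are empty for $x\notin\operatorname{dom} f$. Put $\operatorname{dom}\partial f=\{x:\partial f(x)\ne\emptyset\}$. A proper closed function $f$ is a KL function with exponent $\alpha\in[0,1)$ if for every $\bar x\in\operatorname{dom}\partial f$ there are $c,\epsilon>0$ and $\nu\in(0,\infty]$ such that $\operatorname{dist}(0,\partial f(x))\ge c\,(f(x)-f(\bar x))^{\alpha}$ whenever $\|x-\bar x\|\le\epsilon$ and $f(\bar x)<f(x)<f(\bar x)+\nu$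 (with $\operatorname{dist}(0,\emptyset)=\infty$). Let $A\in\mathbb{R}^{m\times n}$ and let $l:\mathbb{R}^m\to(-\infty,\infty]$ satisfy one of the following two conditions: (i) $l$ is proper, closed and convex with open domain, is strongly convex on every compact convex subset of $\operatorname{dom} l$, and is twice continuously differentiable on $\operatorname{dom} l$; (ii) $l(y)=\max_{u\in D}\{\langle y,u\rangle-q(u)\}$ for all $y\in\mathbb{R}^m$, where $D\subseteq\mathbb{R}^m$ is a polyhedron and $q:\mathbb{R}^m\to\mathbb{R}$ is strongly convex and differentiable with Lipschitz continuous gradient. Theorem. Let $P_1,\dots,P_r:\mathbb{R}^n\to(-\infty,\infty]$ be proper closed polyhedral functions and suppose that $f(x)=l(Ax)+\min_{1\le i\le r}P_i(x)$ is proper and closed and that $f$ is continuous on $\operatorname{dom}\partial f$. Then $f$ is a KL function with exponent $\frac12$. This covers the following models. (a) The logistic loss $y\mapsto\sum_{i=1}^m\log(1+\exp(b_iy_i))$ with all $b_i\neq0$ and the least squares loss $y\mapsto\frac12\|y-b\|^2$ satisfy condition (i). (b) ($\ell_1$-regularized logistic regression) If all $b_i\ne0$ and $\mu>0$, then $x\mapsto\sum_{i=1}^m\log(1+\exp(b_i(Ax)_i))+\mu\|x\|_1$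 is a KL function with exponent $\frac12$. (c) (Cardinality-constrained and sparse index tracking models) Let $l$ satisfy (i) or (ii), let $s\ge1$ be an integer, let $S=\{x\in\mathbb{R}^n:\|x\|_0\le s\}$, where $\|x\|_0$ is the number of nonzero entries of $x$, and let $\Delta=\{x\in\mathbb{R}^n:\sum_jx_j=1,\ x\ge0\}$. Writing $\delta_C$ for the function that is $0$ on $C$ and $\infty$ off $C$, each of the functions $x\mapsto l(Ax)+\delta_S(x)$ and $x\mapsto l(Ax)+\delta_S(x)+\delta_\Delta(x)$, if it is proper, is a KL function with exponent $\frac12$. -/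

import Mathlib

open Filter Topology

noncomputable section

namespace KLExponent

/-! ### Extended-real-valued functions -/

section General

variable {E : Type*}

/-- The effective domain `{x | f x < ∞}`. -/
def effDom (f : E → EReal) : Set E := {x | f x < ⊤}

/-- Proper: never `-∞`, and not identically `∞`. -/
def IsProper (f : E → EReal) : Prop :=
  (∀ x, f x ≠ ⊥) ∧ (effDom f).Nonempty

/-- The epigraph `{(x, s) | f x ≤ s}` in `E × ℝ`. -/
def epigraph (f : E → EReal) : Set (E × ℝ) := {p | f p.1 ≤ (p.2 : EReal)}

/-- The indicator function of `S` : `0` on `S` and `∞` off `S`. -/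
def indicatorFun (S : Set E) (x : E) : EReal :=
  open Classical in if x ∈ S then 0 else ⊤

end General

/-! ### Polyhedra -/

section Polyhedra

variable {V : Type*} [AddCommGroup V] [Module ℝ V]

/-- A polyhedron: the solution set of finitely many affine inequalities. -/
def IsPolyhedron (S : Set V) : Prop :=
  ∃ (k : ℕ) (φ : Fin k → (V →ₗ[ℝ] ℝ)) (β : Fin k → ℝ), S = {v | ∀ i, φ i v ≤ β i}

/-- Convexity of an extended-real-valued function: its epigraph is convex. -/
def IsConvexFun (f : V → EReal) : Prop := Convex ℝ (epigraph f)

/-- A polyhedral function: its epigraph is a polyhedron. -/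
def IsPolyhedralFun (f : V → EReal) : Prop := IsPolyhedron (epigraph f)

end Polyhedra

/-! ### Subdifferentials and the KL exponent -/

section Subdifferential

variable {E : Type*} [NormedAddCommGroup E] [InnerProductSpace ℝ E]

/-- The regular subdifferential; it is empty off the domain of `f`. -/
def regularSubdiff (f : E → EReal) (x : E) : Set E :=
  {v | f x < ⊤ ∧
    0 ≤ liminf (fun z => (f z - f x - ((inner ℝ v (z - x) : ℝ) : EReal)) / ((‖z - x‖ : ℝ) : EReal))
      (𝓝[≠] x)}

/-- The limiting subdifferential; it is empty off the domain of `f`. -/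
def limitingSubdiff (f : E → EReal) (x : E) : Set E :=
  {v | f x < ⊤ ∧ ∃ (xs vs : ℕ → E),
    Tendsto xs atTop (𝓝 x) ∧ Tendsto (fun t => f (xs t)) atTop (𝓝 (f x)) ∧
    Tendsto vs atTop (𝓝 v) ∧ ∀ t, vs t ∈ regularSubdiff f (xs t)}

/-- The set of points at which the limiting subdifferential is nonempty. -/
def domSubdiff (f : E → EReal) : Set E := {x | (limitingSubdiff f x).Nonempty}

/-- The KL property at `xbar` with exponent `α`: for some `c, ε > 0` and `ν ∈ (0, ∞]`,
`dist (0, ∂f(x)) ≥ c (f(x) - f(xbar)) ^ α` whenever `‖x - xbar‖ ≤ ε` and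
`f(xbar) < f(x) < f(xbar) + ν`. The distance is `∞` when `∂f(x)` is empty. -/
def HasKLExponentAt (f : E → EReal) (α : ℝ) (xbar : E) : Prop :=
  ∃ (c ε : ℝ) (ν : EReal), 0 < c ∧ 0 < ε ∧ 0 < ν ∧
    ∀ x, ‖x - xbar‖ ≤ ε → f xbar < f x → f x < f xbar + ν →
      ENNReal.ofReal (c * ((f x).toReal - (f xbar).toReal) ^ α)
        ≤ Metric.infEDist 0 (limitingSubdiff f x)

/-- A KL function with exponent `α`: a proper closed function which has the KL property with
exponent `α` at every point of `dom ∂f`. -/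
def IsKLFunctionWithExponent (f : E → EReal) (α : ℝ) : Prop :=
  IsProper f ∧ LowerSemicontinuous f ∧ ∀ xbar ∈ domSubdiff f, HasKLExponentAt f α xbar

end Subdifferential

/-! ### The two classes of loss functions -/

/-- Proper closed convex, with open domain, strongly convex on every compact convex subset of
the domain (with a modulus depending on the subset) and twice continuously differentiable on
the domain. -/
def IsLocallyStronglyConvexLoss {m : ℕ} (l : EuclideanSpace ℝ (Fin m) → EReal) : Prop :=
  IsProper l ∧ LowerSemicontinuous l ∧ IsConvexFun l ∧ IsOpen (effDom l) ∧
  (∀ K : Set (EuclideanSpace ℝ (Fin m)), IsCompact K → Convex ℝ K → K ⊆ effDom l →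
    ∃ σ : ℝ, 0 < σ ∧ StrongConvexOn K σ (fun y => (l y).toReal)) ∧
  ContDiffOn ℝ 2 (fun y => (l y).toReal) (effDom l)

/-- `l(y) = max_{u ∈ D} (⟨y, u⟩ - q(u))` for a polyhedron `D` and a strongly convex
differentiable `q` with Lipschitz continuous gradient. -/
def IsPolyhedralConjugateLoss {m : ℕ} (l : EuclideanSpace ℝ (Fin m) → EReal) : Prop :=
  ∃ (D : Set (EuclideanSpace ℝ (Fin m))) (q : EuclideanSpace ℝ (Fin m) → ℝ),
    IsPolyhedron D ∧
    (∃ σ : ℝ, 0 < σ ∧ StrongConvexOn Set.univ σ q) ∧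
    Differentiable ℝ q ∧
    (∃ L : NNReal, LipschitzWith L (gradient q)) ∧
    ∀ y, IsGreatest ((fun u => ((inner ℝ y u - q u : ℝ) : EReal)) '' D) (l y)

/-! ### The models -/

/-- The logistic loss `∑ i, log (1 + exp (b i * y i))`. -/
def logisticLoss {m : ℕ} (b : Fin m → ℝ) (y : EuclideanSpace ℝ (Fin m)) : EReal :=
  ((∑ i, Real.log (1 + Real.exp (b i * y i)) : ℝ) : EReal)

/-- The least squares loss `‖y - b‖² / 2`. -/
def leastSquaresLoss {m : ℕ} (b y : EuclideanSpace ℝ (Fin m)) : EReal :=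
  ((‖y - b‖ ^ 2 / 2 : ℝ) : EReal)

/-- The vectors with at most `s` nonzero entries. -/
def sparseSet (n s : ℕ) : Set (EuclideanSpace ℝ (Fin n)) := {x | {i | x i ≠ 0}.ncard ≤ s}

/-- The unit simplex `{x | ∑ i, x i = 1, x ≥ 0}`. -/
def unitSimplex (n : ℕ) : Set (EuclideanSpace ℝ (Fin n)) := {x | ∑ i, x i = 1 ∧ ∀ i, 0 ≤ x i}

end KLExponent

end

open KLExponent

noncomputable section

namespace KLExponent

/-! ### Finitely generated cones -/

section Cones

/-! The function `f` is the minimum of finitely many convex pieces `l ∘ A + P i`. A regular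
subgradient of `f` at a point where a piece is active is a convex subgradient of that piece, because
the piece majorizes `f` and touches it there. By pigeonhole and lower semicontinuity this survives
the passage to limiting subgradients (`exists_subgradient_of_mem_limitingSubdiff`). It therefore
suffices to treat each piece separately, near `x₀` and relative to the level `f x₀`. A piece lying
strictly above that level at `x₀` stays above it nearby, so it imposes nothing.

For an active piece `F` there are two cases. If `x₀` does not minimize `F`, a fixed point with a
smaller value bounds the norms of nearby subgradients away from zero. If `x₀` minimizes `F`, the
exponent `1/2` comes from quadratic growth: some minimizer `z` satisfies `κ ‖x - z‖² ≤ D`, where `D`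
is the gap in value, while a subgradient `v` satisfies `D ≤ ‖v‖ ‖x - z‖`; hence `κ D ≤ ‖v‖²`.

Quadratic growth (`exists_quadratic_growth`) needs only one property of the loss,
`HasConicGrowthAt`. It makes the relevant minimizers solutions of a linear system whose residual is
controlled by `√D`, and Hoffman's bound turns the residual into a distance. In class (i) the cone is
trivial and the property is strong convexity. In class (ii), with `g` the maximizer at `y₀`, the
translated cone is `∇q(g)` plus the normal cone of `D` at `g`, the set of all `y` whose maximizer is
still `g`. -/

lemma exists_bounded_conic_coeff_of_support {ι V : Type*} [Fintype ι] [DecidableEq ι]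
    [NormedAddCommGroup V] [NormedSpace ℝ V] (a : ι → V) (s : Finset ι) :
    ∃ C : ℝ, 0 ≤ C ∧ ∀ l : ι → ℝ, (∀ i, 0 ≤ l i) → (∀ i, i ∉ s → l i = 0) →
      ∃ μ : ι → ℝ, (∀ i, 0 ≤ μ i) ∧ (∀ i, i ∉ s → μ i = 0) ∧
        ∑ i, μ i • a i = ∑ i, l i • a i ∧ ∀ i, μ i ≤ C * ‖∑ i, l i • a i‖ := by
  induction s using Finset.strongInduction with
  | H s ih =>
    by_cases hs : LinearIndepOn ℝ a s
    -- Independent generators: an injective linear map on a finite-dimensional space is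
    -- antilipschitz, which bounds the coefficients.
    · have hinj : LinearMap.ker (Fintype.linearCombination ℝ (fun i : s => a i)) = ⊥ :=
        LinearMap.ker_eq_bot.2 (linearIndependent_iff_injective_fintypeLinearCombination.1 hs)
      obtain ⟨K, -, hK⟩ := LinearMap.exists_antilipschitzWith _ hinj
      refine ⟨K, K.2, fun l hl hls => ⟨l, hl, hls, rfl, fun i => ?_⟩⟩
      by_cases hi : i ∈ s
      · have h1 := hK.le_mul_norm (map_zero _) (fun i : s => l i)
        have h2 : Fintype.linearCombination ℝ (fun i : s => a i) (fun i : s => l i)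
            = ∑ i, l i • a i := by
          rw [Fintype.linearCombination_apply, Finset.sum_coe_sort s (fun i => l i • a i)]
          refine Finset.sum_subset (Finset.subset_univ _) fun i _ hi => ?_
          rw [hls i hi, zero_smul]
        rw [h2] at h1
        refine le_trans (le_trans (le_abs_self _) ?_) h1
        exact norm_le_pi_norm (fun i : s => l i) ⟨i, hi⟩
      · rw [hls i hi]
        positivity
    · obtain ⟨g, hg0, i0, hi0, hgi0⟩ := not_linearIndepOn_finset_iff.1 hs
      obtain ⟨g, hg0, i0, hi0, hgi0⟩ : ∃ g : ι → ℝ, ∑ i ∈ s, g i • a i = 0 ∧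
          ∃ i ∈ s, 0 < g i := by
        rcases lt_or_gt_of_ne hgi0 with h | h
        · refine ⟨-g, ?_, i0, hi0, by simpa using h⟩
          simp [hg0]
        · exact ⟨g, hg0, i0, hi0, h⟩
      have ih' : ∀ i : s, _ := fun i => ih (s.erase i) (Finset.erase_ssubset i.2)
      choose C hC0 hC using ih'
      -- The generator to be discarded depends on `l`, so the constants of all possible erasures are
      -- added.
      refine ⟨∑ i, C i, Finset.sum_nonneg fun i _ => hC0 i, fun l hl hls => ?_⟩
      -- Carathéodory reduction: subtracting `t` times the linear relation `g` keeps the sum. The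
      -- minimal ratio is the largest `t` that keeps all coefficients nonnegative, and it kills the
      -- one at `i1`.
      obtain ⟨i1, hi1, hmin⟩ := Finset.exists_min_image (s.filter fun i => 0 < g i)
        (fun i => l i / g i) ⟨i0, by simp [hi0, hgi0]⟩
      simp only [Finset.mem_filter] at hi1 hmin
      set t := l i1 / g i1 with ht
      have ht0 : 0 ≤ t := div_nonneg (hl _) hi1.2.le
      set l' : ι → ℝ := fun i => if i ∈ s then l i - t * g i else 0 with hl'
      have hsum : ∑ i, l' i • a i = ∑ i, l i • a i := by
        have e1 : ∑ i, l' i • a i = ∑ i ∈ s, (l i - t * g i) • a i := by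
          simp [hl', ite_smul, Finset.sum_ite_mem]
        have e2 : ∑ i, l i • a i = ∑ i ∈ s, l i • a i := by
          refine (Finset.sum_subset (Finset.subset_univ _) fun i _ hi => ?_).symm
          rw [hls i hi, zero_smul]
        rw [e1, e2]
        simp only [sub_smul, mul_smul, Finset.sum_sub_distrib, ← Finset.smul_sum, hg0, smul_zero,
          sub_zero]
      have hl'0 : ∀ i, 0 ≤ l' i := by
        intro i
        simp only [hl']
        split_ifs with hi
        · rcases le_or_gt (g i) 0 with h | h
          · nlinarith [hl i]
          · have := hmin i ⟨hi, h⟩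
            rw [le_div_iff₀ h] at this
            linarith
        · exact le_rfl
      have hl's : ∀ i, i ∉ s.erase i1 → l' i = 0 := by
        intro i hi
        simp only [hl']
        split_ifs with h
        · have : i = i1 := by
            by_contra hne
            exact hi (Finset.mem_erase.2 ⟨hne, h⟩)
          subst this
          rw [ht, div_mul_cancel₀ _ hi1.2.ne', sub_self]
        · rfl
      obtain ⟨μ, hμ0, hμs, hμ, hμC⟩ := hC ⟨i1, hi1.1⟩ l' hl'0 hl's
      rw [hsum] at hμ hμC
      refine ⟨μ, hμ0, fun i hi => hμs i fun h => hi (Finset.mem_of_mem_erase h), hμ,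
        fun i => (hμC i).trans ?_⟩
      gcongr
      exact Finset.single_le_sum (f := C) (fun i _ => hC0 i) (Finset.mem_univ _)

/-- Every element of a finitely generated cone has conic coefficients which are bounded by its
norm and supported where given coefficients are. -/
lemma exists_bounded_conic_coeff {ι V : Type*} [Fintype ι]
    [NormedAddCommGroup V] [NormedSpace ℝ V] (a : ι → V) :
    ∃ C : ℝ, 0 ≤ C ∧ ∀ l : ι → ℝ, (∀ i, 0 ≤ l i) →
      ∃ μ : ι → ℝ, (∀ i, 0 ≤ μ i) ∧ (∀ i, l i = 0 → μ i = 0) ∧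
        ∑ i, μ i • a i = ∑ i, l i • a i ∧ ∀ i, μ i ≤ C * ‖∑ i, l i • a i‖ := by
  classical
  choose C hC0 hC using exists_bounded_conic_coeff_of_support a
  refine ⟨∑ s, C s, Finset.sum_nonneg fun s _ => hC0 s, fun l hl => ?_⟩
  obtain ⟨μ, hμ0, hμs, hμ, hμC⟩ := hC (Finset.univ.filter fun i => l i ≠ 0) l hl (by simp)
  refine ⟨μ, hμ0, fun i hi => hμs i (by simp [hi]), hμ, fun i => (hμC i).trans ?_⟩
  gcongr
  exact Finset.single_le_sum (f := C) (fun i _ => hC0 i) (Finset.mem_univ _)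

/-- The cone generated by a finite family. -/
def coneGen {ι V : Type*} [Fintype ι] [AddCommGroup V] [Module ℝ V] (a : ι → V) : Set V :=
  {v | ∃ l : ι → ℝ, (∀ i, 0 ≤ l i) ∧ v = ∑ i, l i • a i}

/-- Bounded coefficients of a convergent sequence stay in a compact box, so a subsequence of them
converges. -/
lemma isClosed_coneGen {ι V : Type*} [Fintype ι]
    [NormedAddCommGroup V] [NormedSpace ℝ V] (a : ι → V) : IsClosed (coneGen a) := by
  obtain ⟨C, hC0, hC⟩ := exists_bounded_conic_coeff a
  refine IsSeqClosed.isClosed fun v w hv hvw => ?_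
  choose l hl0 hl using hv
  choose μ hμ0 _ hμ hμC using fun k => hC (l k) (hl0 k)
  obtain ⟨M, hM⟩ := hvw.norm.bddAbove_range
  have hmem : ∀ k, μ k ∈ Set.Icc (0 : ι → ℝ) (fun _ => C * M) := fun k => by
    refine ⟨fun i => hμ0 k i, fun i => (hμC k i).trans ?_⟩
    rw [← hl k]
    exact mul_le_mul_of_nonneg_left (hM ⟨k, rfl⟩) hC0
  obtain ⟨μ', hμ', φ, hφ, hlim⟩ := isCompact_Icc.tendsto_subseq hmem
  refine ⟨μ', fun i => hμ'.1 i, ?_⟩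
  have h1 : Tendsto (fun k => ∑ i, μ (φ k) i • a i) atTop (𝓝 (∑ i, μ' i • a i)) :=
    tendsto_finsetSum _ fun i _ => ((tendsto_pi_nhds.1 hlim i).smul_const _)
  have h2 : Tendsto (fun k => v (φ k)) atTop (𝓝 w) := hvw.comp hφ.tendsto_atTop
  refine tendsto_nhds_unique h2 (h1.congr fun k => ?_)
  rw [hμ, ← hl]

lemma convex_coneGen {ι V : Type*} [Fintype ι] [AddCommGroup V] [Module ℝ V] (a : ι → V) :
    Convex ℝ (coneGen a) := by
  rintro _ ⟨l, hl, rfl⟩ _ ⟨μ, hμ, rfl⟩ s t hs ht -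
  refine ⟨fun i => s * l i + t * μ i, fun i => ?_, ?_⟩
  · have := hl i
    have := hμ i
    positivity
  · simp [Finset.smul_sum, add_smul, mul_smul, Finset.sum_add_distrib]

variable {ι V : Type*} [Fintype ι] [NormedAddCommGroup V] [InnerProductSpace ℝ V] [CompleteSpace V]

/-- Projection onto a finitely generated cone. -/
lemma exists_proj_coneGen (a : ι → V) (w : V) :
    ∃ l : ι → ℝ, (∀ i, 0 ≤ l i) ∧ (∀ i, inner ℝ (w - ∑ i, l i • a i) (a i) ≤ 0) ∧
      inner ℝ (w - ∑ i, l i • a i) (∑ i, l i • a i) = 0 := by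
  classical
  have h0 : (0 : V) ∈ coneGen a := ⟨0, by simp, by simp⟩
  obtain ⟨p, ⟨l, hl, rfl⟩, hp⟩ := exists_norm_eq_iInf_of_complete_convex ⟨0, h0⟩
    (isClosed_coneGen a).isComplete (convex_coneGen a) w
  rw [norm_eq_iInf_iff_real_inner_le_zero (convex_coneGen a) ⟨l, hl, rfl⟩] at hp
  refine ⟨l, hl, fun i => ?_, le_antisymm ?_ ?_⟩
  -- With `p` the projection, the variational inequality is tested at `p + a i`, `2p` and `0`.
  · have := hp (∑ j, l j • a j + a i) ⟨fun j => l j + if j = i then 1 else 0, fun j => ?_, ?_⟩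
    · simpa using this
    · have := hl j
      positivity
    · simp [add_smul, Finset.sum_add_distrib]
  · have := hp (∑ j, l j • a j + ∑ j, l j • a j) ⟨fun j => l j + l j, fun j => ?_, ?_⟩
    · simpa using this
    · have := hl j
      positivity
    · simp [add_smul, Finset.sum_add_distrib]
  · have := hp 0 h0
    simpa using this

/-- Farkas' lemma. -/
lemma mem_coneGen_of_forall_inner (a : ι → V) (w : V)
    (h : ∀ d, (∀ i, inner ℝ d (a i) ≤ 0) → inner ℝ d w ≤ 0) :
    w ∈ coneGen a := by
  obtain ⟨l, hl, h1, h2⟩ := exists_proj_coneGen a w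
  refine ⟨l, hl, ?_⟩
  have h3 := h _ h1
  have h4 : inner ℝ (w - ∑ i, l i • a i) (w - ∑ i, l i • a i) ≤ 0 := by
    rw [inner_sub_right, h2]
    simpa using h3
  exact sub_eq_zero.1 (real_inner_self_nonpos.1 h4)

end Cones

/-! ### Hoffman's error bound -/

section Hoffman

variable {ι V : Type*} [NormedAddCommGroup V] [InnerProductSpace ℝ V]

/-- Near a point of a polyhedron, only the active constraints matter. -/
lemma exists_feasible_radius [Finite ι] (a : ι → V) (β : ι → ℝ) {p : V} (hp : ∀ i, inner ℝ (a i) p ≤ β i) :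
    ∃ ρ : ℝ, 0 < ρ ∧ ∀ d, ‖d‖ ≤ ρ → (∀ i, inner ℝ (a i) p = β i → inner ℝ (a i) d ≤ 0) →
      ∀ i, inner ℝ (a i) (p + d) ≤ β i := by
  have h : ∀ᶠ d in 𝓝 (0 : V), ∀ i, inner ℝ (a i) p = β i ∨ inner ℝ (a i) (p + d) ≤ β i := by
    refine eventually_all.2 fun i => ?_
    rcases eq_or_lt_of_le (hp i) with h | h
    · exact Eventually.of_forall fun d => Or.inl h
    · have hc : ContinuousAt (fun d => inner ℝ (a i) (p + d)) (0 : V) := by fun_prop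
      have := hc.eventually (Iio_mem_nhds (show inner ℝ (a i) (p + 0) < β i by simpa using h))
      filter_upwards [this] with d hd using Or.inr (le_of_lt hd)
  obtain ⟨ρ, hρ, hball⟩ := Metric.eventually_nhds_iff.1 h
  refine ⟨ρ / 2, half_pos hρ, fun d hd hact i => ?_⟩
  rcases hball (y := d) (by rw [dist_zero_right]; linarith) i with h | h
  · rw [inner_add_right, h]
    linarith [hact i h]
  · exact h

/-- Let `p` be the projection of `x`. By Farkas, `x - p` is a conic combination of the active
normals, with coefficients at most `C ‖x - p‖`. Pairing it with `x - p` turns each active term into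
a constraint violation, and one factor `‖x - p‖` cancels. -/
lemma hoffman_inner [FiniteDimensional ℝ V] [Fintype ι] (a : ι → V) (β : ι → ℝ)
    (hne : ∃ x, ∀ i, inner ℝ (a i) x ≤ β i) :
    ∃ K : ℝ, 0 < K ∧ ∀ x, ∃ p, (∀ i, inner ℝ (a i) p ≤ β i) ∧
      ‖x - p‖ ≤ K * ∑ i, max 0 (inner ℝ (a i) x - β i) := by
  classical
  obtain ⟨C, hC0, hC⟩ := exists_bounded_conic_coeff a
  refine ⟨C + 1, by positivity, fun x => ?_⟩
  have hS : IsClosed {x : V | ∀ i, inner ℝ (a i) x ≤ β i} := by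
    simp only [Set.ofPred_forall]
    exact isClosed_iInter fun i => isClosed_le (by fun_prop) continuous_const
  have hconv : Convex ℝ {x : V | ∀ i, inner ℝ (a i) x ≤ β i} := by
    intro x hx y hy s t hs ht hst i
    rw [inner_add_right, inner_smul_right, inner_smul_right]
    have h1 := mul_le_mul_of_nonneg_left (hx i) hs
    have h2 := mul_le_mul_of_nonneg_left (hy i) ht
    calc _ ≤ s * β i + t * β i := add_le_add h1 h2
      _ = β i := by rw [← add_mul, hst, one_mul]
  obtain ⟨p, hpS, hp⟩ := exists_norm_eq_iInf_of_complete_convex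
    (K := {x : V | ∀ i, inner ℝ (a i) x ≤ β i}) hne hS.isComplete hconv x
  rw [norm_eq_iInf_iff_real_inner_le_zero hconv hpS] at hp
  refine ⟨p, hpS, ?_⟩
  obtain ⟨ρ, hρ, hfeas⟩ := exists_feasible_radius a β hpS
  have hmem : x - p ∈ coneGen (fun i => if inner ℝ (a i) p = β i then a i else 0) := by
    refine mem_coneGen_of_forall_inner _ _ fun d hd => ?_
    have hd0 : 0 < ‖d‖ + 1 := by positivity
    have hmem := hp (p + (ρ / (‖d‖ + 1)) • d) (hfeas _ ?_ fun i hi => ?_)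
    · rw [add_sub_cancel_left, inner_smul_right, real_inner_comm] at hmem
      exact nonpos_of_mul_nonpos_right hmem (by positivity)
    · rw [norm_smul, Real.norm_of_nonneg (by positivity), div_mul_eq_mul_div, div_le_iff₀ hd0]
      nlinarith [norm_nonneg d]
    · rw [inner_smul_right]
      have := hd i
      rw [if_pos hi, real_inner_comm] at this
      exact mul_nonpos_of_nonneg_of_nonpos (by positivity) this
  obtain ⟨l, hl, hlx⟩ := hmem
  -- Moving the cutoff from generators to coefficients lets the same `C` serve every active set;
  -- bounded coefficients keep the zeros.
  have hlx' : x - p = ∑ i, (if inner ℝ (a i) p = β i then l i else 0) • a i := by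
    rw [hlx]
    refine Finset.sum_congr rfl fun i _ => ?_
    dsimp only
    split_ifs <;> simp
  obtain ⟨μ, hμ0, hμs, hμ, hμC⟩ := hC (fun i => if inner ℝ (a i) p = β i then l i else 0)
    (fun i => by split_ifs; exacts [hl i, le_rfl])
  rw [← hlx'] at hμ hμC
  have key : ‖x - p‖ * ‖x - p‖ ≤
      ‖x - p‖ * (C * ∑ i, max 0 (inner ℝ (a i) x - β i)) := by
    calc ‖x - p‖ * ‖x - p‖ = inner ℝ (∑ i, μ i • a i) (x - p) := by
          rw [hμ, real_inner_self_eq_norm_mul_norm]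
      _ = ∑ i, μ i * inner ℝ (a i) (x - p) := by
          rw [sum_inner]
          simp [inner_smul_left]
      _ ≤ ∑ i, (C * ‖x - p‖) * max 0 (inner ℝ (a i) x - β i) := by
          refine Finset.sum_le_sum fun i _ => ?_
          by_cases hi : inner ℝ (a i) p = β i
          · rw [inner_sub_right, hi]
            refine mul_le_mul_of_nonneg (hμC i) (le_max_right _ _) (hμ0 i) (le_max_left _ _)
          · rw [hμs i (if_neg hi), zero_mul]
            positivity
      _ = _ := by rw [← Finset.mul_sum]; ring
  have hsum : 0 ≤ ∑ i, max 0 (inner ℝ (a i) x - β i) :=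
    Finset.sum_nonneg fun i _ => le_max_left _ _
  rcases (norm_nonneg (x - p)).eq_or_lt with h | h
  · rw [← h]
    positivity
  · have := le_of_mul_le_mul_left key h
    nlinarith

/-- Hoffman's error bound for a system of linear inequalities. -/
lemma hoffman {ι W : Type*} [Fintype ι] [NormedAddCommGroup W] [NormedSpace ℝ W]
    [FiniteDimensional ℝ W] (φ : ι → W →ₗ[ℝ] ℝ) (β : ι → ℝ) (hne : ∃ x, ∀ i, φ i x ≤ β i) :
    ∃ K : ℝ, 0 < K ∧ ∀ x, ∃ p, (∀ i, φ i p ≤ β i) ∧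
      ‖x - p‖ ≤ K * ∑ i, max 0 (φ i x - β i) := by
  -- The bound is transported from Euclidean space because it will be applied to a product, whose
  -- sup norm is not Hilbertian.
  let e := toEuclidean (E := W)
  let a : ι → EuclideanSpace ℝ (Fin (Module.finrank ℝ W)) := fun i =>
    (InnerProductSpace.toDual ℝ _).symm
      (LinearMap.toContinuousLinearMap (φ i ∘ₗ (e.symm : _ →ₗ[ℝ] W)))
  have ha : ∀ i y, inner ℝ (a i) y = φ i (e.symm y) := fun i y => by
    simp [a]
  obtain ⟨x0, hx0⟩ := hne
  obtain ⟨K, hK0, hK⟩ := hoffman_inner a β ⟨e x0, fun i => by rw [ha]; simpa using hx0 i⟩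
  let E' : EuclideanSpace ℝ (Fin (Module.finrank ℝ W)) →L[ℝ] W := e.symm
  refine ⟨(‖E'‖ + 1) * K, by positivity, fun x => ?_⟩
  obtain ⟨p, hp, hpK⟩ := hK (e x)
  refine ⟨e.symm p, fun i => by rw [← ha]; exact hp i, ?_⟩
  have h1 : x - e.symm p = E' (e x - p) := by simp [E']
  simp only [ha, ContinuousLinearEquiv.symm_apply_apply] at hpK
  calc ‖x - e.symm p‖ ≤ ‖E'‖ * ‖e x - p‖ := by
        rw [h1]; exact ContinuousLinearMap.le_opNorm _ _
    _ ≤ (‖E'‖ + 1) * ‖e x - p‖ := by gcongr; linarith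
    _ ≤ _ := by rw [mul_assoc]; gcongr

/-- Hoffman's error bound for a system of linear inequalities and equations. -/
lemma hoffman_with_equations {ι W Y : Type*} [Fintype ι] [NormedAddCommGroup W] [NormedSpace ℝ W]
    [FiniteDimensional ℝ W] [NormedAddCommGroup Y] [InnerProductSpace ℝ Y] [FiniteDimensional ℝ Y]
    (φ : ι → W →ₗ[ℝ] ℝ) (β : ι → ℝ) (T : W →ₗ[ℝ] Y) (c : Y)
    (hne : ∃ x, (∀ i, φ i x ≤ β i) ∧ T x = c) :
    ∃ K : ℝ, 0 < K ∧ ∀ x, ∃ p, (∀ i, φ i p ≤ β i) ∧ T p = c ∧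
      ‖x - p‖ ≤ K * (∑ i, max 0 (φ i x - β i) + ‖T x - c‖) := by
  let b := stdOrthonormalBasis ℝ Y
  let ψ : ι ⊕ (Fin (Module.finrank ℝ Y) ⊕ Fin (Module.finrank ℝ Y)) → W →ₗ[ℝ] ℝ :=
    Sum.elim φ (Sum.elim (fun j => (innerₛₗ ℝ (b j)) ∘ₗ T) (fun j => -((innerₛₗ ℝ (b j)) ∘ₗ T)))
  let γ : ι ⊕ (Fin (Module.finrank ℝ Y) ⊕ Fin (Module.finrank ℝ Y)) → ℝ :=
    Sum.elim β (Sum.elim (fun j => inner ℝ (b j) c) (fun j => -inner ℝ (b j) c))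
  obtain ⟨x0, hx0, hTx0⟩ := hne
  obtain ⟨K, hK0, hK⟩ := hoffman ψ γ ⟨x0, by
    rintro (i | j | j)
    · exact hx0 i
    · simp [ψ, γ, hTx0]
    · simp [ψ, γ, hTx0]⟩
  set d : ℝ := (Module.finrank ℝ Y : ℝ)
  -- Each of the `d` coordinate equations is two inequalities, each violated by at most `‖T x - c‖`.
  refine ⟨K * (1 + 2 * d), by positivity, fun x => ?_⟩
  obtain ⟨p, hp, hpK⟩ := hK x
  refine ⟨p, fun i => hp (Sum.inl i), ?_, hpK.trans ?_⟩
  · refine b.toBasis.ext_elem fun j => ?_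
    have h1 := hp (Sum.inr (Sum.inl j))
    have h2 := hp (Sum.inr (Sum.inr j))
    simp only [ψ, γ, Sum.elim_inr, Sum.elim_inl, LinearMap.neg_apply, LinearMap.comp_apply,
      innerₛₗ_apply_apply] at h1 h2
    simp only [OrthonormalBasis.coe_toBasis_repr_apply, OrthonormalBasis.repr_apply_apply]
    linarith
  · rw [mul_assoc]
    gcongr
    rw [Fintype.sum_sum_type, Fintype.sum_sum_type]
    have hj : ∀ j, |inner ℝ (b j) (T x) - inner ℝ (b j) c| ≤ ‖T x - c‖ := fun j => by
      rw [← inner_sub_right]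
      simpa using abs_real_inner_le_norm (b j) (T x - c)
    have h1 : ∑ j, max 0 (ψ (Sum.inr (Sum.inl j)) x - γ (Sum.inr (Sum.inl j))) ≤ d * ‖T x - c‖ := by
      refine (Finset.sum_le_card_nsmul _ _ ‖T x - c‖ fun j _ => ?_).trans (by simp [d])
      refine max_le (norm_nonneg _) (le_trans ?_ (hj j))
      exact le_abs_self _
    have h2 : ∑ j, max 0 (ψ (Sum.inr (Sum.inr j)) x - γ (Sum.inr (Sum.inr j))) ≤ d * ‖T x - c‖ := by
      refine (Finset.sum_le_card_nsmul _ _ ‖T x - c‖ fun j _ => ?_).trans (by simp [d])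
      refine max_le (norm_nonneg _) (le_trans ?_ (hj j))
      simp only [ψ, γ, Sum.elim_inr, LinearMap.neg_apply, LinearMap.comp_apply,
        innerₛₗ_apply_apply]
      rw [← abs_neg]
      refine le_trans (le_of_eq ?_) (le_abs_self _)
      ring
    have h3 : 0 ≤ ∑ i, max 0 (φ i x - β i) := Finset.sum_nonneg fun i _ => le_max_left _ _
    have hd : 0 ≤ d := by positivity
    have h4 : ∑ i, max 0 (ψ (Sum.inl i) x - γ (Sum.inl i)) = ∑ i, max 0 (φ i x - β i) := rfl
    rw [h4]
    nlinarith [norm_nonneg (T x - c), mul_nonneg hd h3]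

end Hoffman

/-! ### Convex composite functions with polyhedral part -/

section Composite

/-- Around `y₀`, the excess of `h` over its linearization with gradient `g` grows at least
quadratically in the distance to a translated finitely generated cone, on which the excess is
nonpositive. -/
def HasConicGrowthAt {Y : Type*} [NormedAddCommGroup Y] [InnerProductSpace ℝ Y]
    (Ω : Set Y) (h : Y → ℝ) (y₀ g : Y) : Prop :=
  ∃ (k : ℕ) (a : Fin k → Y) (w : Y) (κ ρ : ℝ), 0 < κ ∧ 0 < ρ ∧
    (∀ y ∈ Ω, ‖y - y₀‖ ≤ ρ → ∃ l : Fin k → ℝ, (∀ i, 0 ≤ l i) ∧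
      κ * ‖y - w - ∑ i, l i • a i‖ ^ 2 ≤ h y - h y₀ - inner ℝ g (y - y₀)) ∧
    ∀ l : Fin k → ℝ, (∀ i, 0 ≤ l i) → w + ∑ i, l i • a i ∈ Ω ∧
      h (w + ∑ i, l i • a i) ≤ h y₀ + inner ℝ g (w + ∑ i, l i • a i - y₀)

/-- The epigraph of a real-valued function on a set. -/
def realEpigraph {E : Type*} (C : Set E) (p : E → ℝ) : Set (E × ℝ) :=
  {v | v.1 ∈ C ∧ p v.1 ≤ v.2}

lemma IsPolyhedron.convex {V : Type*} [AddCommGroup V] [Module ℝ V] {S : Set V}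
    (hS : IsPolyhedron S) : Convex ℝ S := by
  obtain ⟨k, φ, β, rfl⟩ := hS
  intro x hx y hy s t hs ht hst i
  rw [map_add, map_smul, map_smul, smul_eq_mul, smul_eq_mul]
  have h1 := mul_le_mul_of_nonneg_left (hx i) hs
  have h2 := mul_le_mul_of_nonneg_left (hy i) ht
  calc _ ≤ s * β i + t * β i := add_le_add h1 h2
    _ = β i := by rw [← add_mul, hst, one_mul]

lemma convexOn_of_convex_realEpigraph {E : Type*} [AddCommGroup E] [Module ℝ E] {C : Set E}
    {p : E → ℝ} (h : Convex ℝ (realEpigraph C p)) : ConvexOn ℝ C p := by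
  have key : ∀ x ∈ C, ∀ y ∈ C, ∀ a b : ℝ, 0 ≤ a → 0 ≤ b → a + b = 1 →
      (a • (x, p x) + b • (y, p y) : E × ℝ) ∈ realEpigraph C p := fun x hx y hy a b ha hb hab =>
    h (x := (x, p x)) ⟨hx, le_rfl⟩ (y := (y, p y)) ⟨hy, le_rfl⟩ ha hb hab
  exact ⟨fun x hx y hy a b ha hb hab => (key x hx y hy a b ha hb hab).1,
    fun x hx y hy a b ha hb hab => (key x hx y hy a b ha hb hab).2⟩

variable {E Y : Type*} [NormedAddCommGroup E] [InnerProductSpace ℝ E]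
  [NormedAddCommGroup Y] [InnerProductSpace ℝ Y]

lemma _root_.HasGradientAt.hasDerivAt_line [CompleteSpace Y] {h : Y → ℝ} {g y₀ : Y}
    (hg : HasGradientAt h g y₀) (d : Y) :
    HasDerivAt (fun t : ℝ => h (y₀ + t • d)) (inner ℝ g d) 0 := by
  have h1 : HasDerivAt (fun t : ℝ => y₀ + t • d) d 0 := by
    simpa using ((hasDerivAt_id (0 : ℝ)).smul_const d).const_add y₀
  have h2 := hg.hasFDerivAt
  rw [show y₀ = y₀ + (0 : ℝ) • d by simp] at h2
  have h3 := h2.comp_hasDerivAt (0 : ℝ) h1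
  rw [InnerProductSpace.toDual_apply_apply] at h3
  exact h3

/-- First-order optimality condition for `h ∘ A + p` with `p` convex. -/
lemma le_add_inner_of_isMin [CompleteSpace Y] {C : Set E} {p : E → ℝ} (hp : ConvexOn ℝ C p) (A : E →ₗ[ℝ] Y)
    {Ω : Set Y} {h : Y → ℝ} {x₀ : E} {g : Y} (hx₀ : x₀ ∈ C) (hΩ : Ω ∈ 𝓝 (A x₀))
    (hg : HasGradientAt h g (A x₀))
    (hmin : ∀ x ∈ C, A x ∈ Ω → h (A x₀) + p x₀ ≤ h (A x) + p x) {x : E} (hx : x ∈ C) :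
    p x₀ ≤ p x + inner ℝ g (A x - A x₀) := by
  set d := A x - A x₀ with hd
  have hline := hg.hasDerivAt_line d
  have hlim := hline.tendsto_slope_zero_right
  have hcont : Tendsto (fun t : ℝ => A x₀ + t • d) (𝓝[>] 0) (𝓝 (A x₀)) := by
    have : ContinuousAt (fun t : ℝ => A x₀ + t • d) 0 := by fun_prop
    have := this.tendsto.mono_left (nhdsWithin_le_nhds (s := Set.Ioi 0))
    simpa using this
  -- Minimality along the segment to `x`, divided by `t`; convexity is needed only of `p`.
  have hev : ∀ᶠ t : ℝ in 𝓝[>] 0, p x₀ - p x ≤ t⁻¹ • (h (A x₀ + (0 + t) • d)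
      - h (A x₀ + (0 : ℝ) • d)) := by
    filter_upwards [hcont.eventually_mem hΩ, self_mem_nhdsWithin,
      Ioo_mem_nhdsGT (zero_lt_one' ℝ)] with t ht ht0 ht1
    have ht0 : 0 < t := ht0
    have hxt : (1 - t) • x₀ + t • x ∈ C :=
      hp.1 hx₀ hx (by linarith [ht1.2]) ht0.le (by ring)
    have hpt := hp.2 hx₀ hx (sub_nonneg.2 ht1.2.le) ht0.le (by ring)
    have hA : A ((1 - t) • x₀ + t • x) = A x₀ + t • d := by
      rw [map_add, map_smul, map_smul, hd]
      module
    have := hmin _ hxt (by rw [hA]; exact ht)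
    rw [hA] at this
    simp only [smul_eq_mul] at hpt
    rw [zero_add, zero_smul, add_zero, smul_eq_mul, ← div_eq_inv_mul, le_div_iff₀ ht0]
    linarith
  have := ge_of_tendsto hlim hev
  linarith

variable [FiniteDimensional ℝ E] [FiniteDimensional ℝ Y]

/-- Quadratic growth away from the set of minimizers. -/
lemma exists_quadratic_growth {C : Set E} {p : E → ℝ} (hp : IsPolyhedron (realEpigraph C p))
    (A : E →ₗ[ℝ] Y) {Ω : Set Y} {h : Y → ℝ} {x₀ : E} {g : Y} (hx₀ : x₀ ∈ C)
    (hΩ : Ω ∈ 𝓝 (A x₀)) (hg : HasGradientAt h g (A x₀)) (hgrow : HasConicGrowthAt Ω h (A x₀) g)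
    (hmin : ∀ x ∈ C, A x ∈ Ω → h (A x₀) + p x₀ ≤ h (A x) + p x) :
    ∃ κ ε : ℝ, 0 < κ ∧ 0 < ε ∧ ∀ x ∈ C, A x ∈ Ω → ‖x - x₀‖ ≤ ε →
      h (A x) + p x < h (A x₀) + p x₀ + 1 →
      ∃ z ∈ C, A z ∈ Ω ∧ h (A z) + p z ≤ h (A x₀) + p x₀ ∧
        κ * ‖x - z‖ ^ 2 ≤ h (A x) + p x - (h (A x₀) + p x₀) := by
  have hopt := fun x hx => le_add_inner_of_isMin
    (convexOn_of_convex_realEpigraph hp.convex) A hx₀ hΩ hg hmin (x := x) hx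
  obtain ⟨N, φ, β, hφ⟩ := hp
  obtain ⟨k, a, w, κ, ρ, hκ, hρ, hlow, hup⟩ := hgrow
  obtain ⟨l₀, hl₀, hl₀w⟩ := hlow (A x₀) (mem_of_mem_nhds hΩ) (by simpa using hρ.le)
  -- At `y = y₀` the excess vanishes, so `y₀` lies in the translated cone. This makes the linear
  -- system below feasible.
  have hy₀ : A x₀ - ∑ i, l₀ i • a i = w := by
    rw [sub_self, sub_self, inner_zero_right, sub_zero] at hl₀w
    have h1 : ‖A x₀ - w - ∑ i, l₀ i • a i‖ ^ 2 ≤ 0 := nonpos_of_mul_nonpos_right hl₀w hκ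
    have h2 : A x₀ - w - ∑ i, l₀ i • a i = 0 := by
      rw [← norm_eq_zero]
      exact pow_eq_zero_iff two_ne_zero |>.1 (le_antisymm h1 (by positivity))
    rw [← sub_eq_zero, ← h2]
    abel
  -- The system in `(z, s, μ)`: `(z, s)` is in the epigraph of `p`, `s + ⟨g, A z⟩ ≤ p x₀ + ⟨g, A
  -- x₀⟩`, `μ ≥ 0` and `A z = w + ∑ μ i • a i`. Any solution has objective value at most that of
  -- `x₀`.
  let π₁ : E × ℝ × (Fin k → ℝ) →ₗ[ℝ] E := LinearMap.fst ℝ _ _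
  let π₂ : E × ℝ × (Fin k → ℝ) →ₗ[ℝ] ℝ := LinearMap.fst ℝ _ _ ∘ₗ LinearMap.snd ℝ _ _
  let π₃ : E × ℝ × (Fin k → ℝ) →ₗ[ℝ] (Fin k → ℝ) := LinearMap.snd ℝ _ _ ∘ₗ LinearMap.snd ℝ _ _
  let ψ : Fin N ⊕ (Unit ⊕ Fin k) → E × ℝ × (Fin k → ℝ) →ₗ[ℝ] ℝ :=
    Sum.elim (fun i => φ i ∘ₗ π₁.prod π₂)
      (Sum.elim (fun _ => π₂ + innerₛₗ ℝ g ∘ₗ A ∘ₗ π₁) (fun j => -(LinearMap.proj j ∘ₗ π₃)))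
  let γ : Fin N ⊕ (Unit ⊕ Fin k) → ℝ :=
    Sum.elim β (Sum.elim (fun _ => p x₀ + inner ℝ g (A x₀)) (fun _ => 0))
  let T : E × ℝ × (Fin k → ℝ) →ₗ[ℝ] Y := A ∘ₗ π₁ - Fintype.linearCombination ℝ a ∘ₗ π₃
  have hψ1 : ∀ i v, ψ (Sum.inl i) v = φ i (v.1, v.2.1) := fun i v => rfl
  have hψ2 : ∀ v, ψ (Sum.inr (Sum.inl ())) v = v.2.1 + inner ℝ g (A v.1) := fun v => rfl
  have hψ3 : ∀ j v, ψ (Sum.inr (Sum.inr j)) v = - v.2.2 j := fun j v => rfl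
  have hT : ∀ v, T v = A v.1 - ∑ i, v.2.2 i • a i := fun v => rfl
  have hφC : ∀ x s, (∀ i, φ i (x, s) ≤ β i) ↔ x ∈ C ∧ p x ≤ s := fun x s => by
    have : (x, s) ∈ realEpigraph C p ↔ (x, s) ∈ {v | ∀ i, φ i v ≤ β i} := by rw [hφ]
    exact this.symm
  obtain ⟨K, hK0, hK⟩ := hoffman_with_equations ψ γ T w ⟨(x₀, p x₀, l₀), by
    refine ⟨?_, by rw [hT]; exact hy₀⟩
    rintro (i | i | j)
    · exact ((hφC x₀ (p x₀)).2 ⟨hx₀, le_rfl⟩) i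
    · exact le_rfl
    · exact neg_nonpos.2 (hl₀ j)⟩
  have hAc : ContinuousAt A x₀ := (LinearMap.continuous_of_finiteDimensional A).continuousAt
  obtain ⟨ε, hε, hball⟩ := Metric.continuousAt_iff.1 hAc ρ hρ
  refine ⟨1 / (K ^ 2 * (2 + 2 / κ)), ε / 2, by positivity, half_pos hε,
    fun x hxC hxΩ hxε hxν => ?_⟩
  obtain ⟨l, hl, hlx⟩ := hlow (A x) hxΩ (by
    rw [← dist_eq_norm]
    exact (hball (by rw [dist_eq_norm]; linarith)).le)
  obtain ⟨⟨z, s, μ⟩, hz, hTz, hzK⟩ := hK (x, p x, l)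
  have hzC := (hφC z s).1 fun i => hz (Sum.inl i)
  have hzs : s + inner ℝ g (A z) ≤ p x₀ + inner ℝ g (A x₀) := hz (Sum.inr (Sum.inl ()))
  have hμ : ∀ j, 0 ≤ μ j := fun j => neg_nonpos.1 (hz (Sum.inr (Sum.inr j)))
  have hAz : A z = w + ∑ i, μ i • a i := by
    rw [← hTz, hT]
    simp
  obtain ⟨hzΩ, hzh⟩ := hup μ hμ
  rw [← hAz] at hzΩ hzh
  refine ⟨z, hzC.1, hzΩ, ?_, ?_⟩
  · rw [inner_sub_right] at hzh
    linarith [hzC.2]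
  · set G := p x + inner ℝ g (A x) - (p x₀ + inner ℝ g (A x₀)) with hG
    set δ := ‖A x - w - ∑ i, l i • a i‖ with hδ
    have hG0 : 0 ≤ G := by
      have := hopt x hxC
      rw [inner_sub_right] at this
      linarith
    have hδ0 : 0 ≤ δ := norm_nonneg _
    -- At `(x, p x, l)` only the linearized objective inequality can fail, by `G`, and the equation,
    -- by `δ`.
    have hsum : ∑ i, max 0 (ψ i (x, p x, l) - γ i) = G := by
      rw [Fintype.sum_sum_type, Fintype.sum_sum_type]
      have e1 : ∀ i, max 0 (ψ (Sum.inl i) (x, p x, l) - γ (Sum.inl i)) = 0 := fun i =>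
        max_eq_left (sub_nonpos.2 (((hφC x (p x)).2 ⟨hxC, le_rfl⟩) i))
      have e2 : ∀ j, max 0 (ψ (Sum.inr (Sum.inr j)) (x, p x, l) - γ (Sum.inr (Sum.inr j))) = 0 :=
        fun j => max_eq_left (sub_nonpos.2 (neg_nonpos.2 (hl j)))
      simp only [e1, e2, Finset.sum_const_zero, zero_add, add_zero, Finset.univ_unique,
        Finset.sum_singleton]
      exact max_eq_right hG0
    have hTx : T (x, p x, l) - w = A x - w - ∑ i, l i • a i := by
      rw [hT]
      abel
    rw [hsum, hTx, ← hδ] at hzK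
    have hxz : ‖x - z‖ ≤ K * (G + δ) := (norm_fst_le ((x, p x, l) - (z, s, μ))).trans hzK
    have hD : κ * δ ^ 2 + G ≤ h (A x) + p x - (h (A x₀) + p x₀) := by
      rw [inner_sub_right] at hlx
      linarith
    have hκδ : 0 ≤ κ * δ ^ 2 := by positivity
    -- Hence `G² ≤ G`: the linear gap may be squared at no cost, which puts `(G + δ)²` below a
    -- multiple of `κ δ² + G`.
    have hG1 : G ≤ 1 := by linarith
    have hsq : ‖x - z‖ ^ 2 ≤ K ^ 2 * (G + δ) ^ 2 := by
      rw [← mul_pow]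
      gcongr
    have h1 : (G + δ) ^ 2 ≤ (2 + 2 / κ) * (κ * δ ^ 2 + G) := by
      have e : (2 + 2 / κ) * (κ * δ ^ 2 + G) = 2 * (κ * δ ^ 2) + 2 * δ ^ 2 + 2 * G + 2 / κ * G := by
        field_simp
        ring
      rw [e]
      have : 0 ≤ 2 / κ * G := by positivity
      nlinarith [sq_nonneg (G - δ)]
    rw [div_mul_eq_mul_div, one_mul, div_le_iff₀ (by positivity)]
    calc ‖x - z‖ ^ 2 ≤ K ^ 2 * (G + δ) ^ 2 := hsq
      _ ≤ K ^ 2 * ((2 + 2 / κ) * (κ * δ ^ 2 + G)) := by gcongr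
      _ ≤ K ^ 2 * ((2 + 2 / κ) * (h (A x) + p x - (h (A x₀) + p x₀))) := by gcongr
      _ = _ := by ring

/-- The Kurdyka–Łojasiewicz inequality with exponent `1/2` for the convex subgradients of
`h ∘ A + p`. -/
lemma exists_kl_inequality {C : Set E} {p : E → ℝ} (hp : IsPolyhedron (realEpigraph C p))
    (A : E →ₗ[ℝ] Y) {Ω : Set Y} {h : Y → ℝ} {x₀ : E} {g : Y} (hx₀ : x₀ ∈ C)
    (hΩ : Ω ∈ 𝓝 (A x₀)) (hg : HasGradientAt h g (A x₀)) (hgrow : HasConicGrowthAt Ω h (A x₀) g) :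
    ∃ c ε ν : ℝ, 0 < c ∧ 0 < ε ∧ 0 < ν ∧ ∀ x ∈ C, A x ∈ Ω → ‖x - x₀‖ ≤ ε →
      h (A x₀) + p x₀ < h (A x) + p x → h (A x) + p x < h (A x₀) + p x₀ + ν →
      ∀ v : E, (∀ z ∈ C, A z ∈ Ω → h (A x) + p x + inner ℝ v (z - x) ≤ h (A z) + p z) →
        c * (h (A x) + p x - (h (A x₀) + p x₀)) ^ (1 / 2 : ℝ) ≤ ‖v‖ := by
  simp only [← Real.sqrt_eq_rpow]
  by_cases hmin : ∀ x ∈ C, A x ∈ Ω → h (A x₀) + p x₀ ≤ h (A x) + p x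
  · obtain ⟨κ, ε, hκ, hε, H⟩ := exists_quadratic_growth hp A hx₀ hΩ hg hgrow hmin
    refine ⟨√κ, ε, 1, by positivity, hε, one_pos, fun x hxC hxΩ hxε hlt hν v hv => ?_⟩
    obtain ⟨z, hzC, hzΩ, hz, hzκ⟩ := H x hxC hxΩ hxε hν
    have hvz := hv z hzC hzΩ
    set D := h (A x) + p x - (h (A x₀) + p x₀)
    have hD : 0 < D := sub_pos.2 hlt
    have h1 : D ≤ ‖v‖ * ‖x - z‖ := by
      have h2 := abs_real_inner_le_norm v (z - x)
      rw [norm_sub_rev z x] at h2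
      have h3 := neg_abs_le (inner ℝ v (z - x))
      linarith
    have h4 : D * (κ * D) ≤ D * ‖v‖ ^ 2 := by
      calc D * (κ * D) = κ * D ^ 2 := by ring
        _ ≤ κ * (‖v‖ * ‖x - z‖) ^ 2 := by gcongr
        _ = ‖v‖ ^ 2 * (κ * ‖x - z‖ ^ 2) := by ring
        _ ≤ ‖v‖ ^ 2 * D := by gcongr
        _ = _ := by ring
    rw [← Real.sqrt_mul hκ.le]
    exact Real.sqrt_le_iff.2 ⟨norm_nonneg _, le_of_mul_le_mul_left h4 hD⟩
  -- A fixed `z` with a smaller value forces a slope of at least `δ / (‖x₀ - z‖ + 1)` on the unit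
  -- ball around `x₀`, and `ν = 1` keeps the square root at most `1`.
  · push Not at hmin
    obtain ⟨z, hzC, hzΩ, hz⟩ := hmin
    set δ := h (A x₀) + p x₀ - (h (A z) + p z)
    have hδ : 0 < δ := sub_pos.2 hz
    refine ⟨δ / (‖x₀ - z‖ + 1), 1, 1, by positivity, one_pos, one_pos,
      fun x hxC hxΩ hxε hlt hν v hv => ?_⟩
    have hvz := hv z hzC hzΩ
    have h2 := abs_real_inner_le_norm v (z - x)
    have h3 := neg_abs_le (inner ℝ v (z - x))
    have h4 : ‖z - x‖ ≤ ‖x₀ - z‖ + 1 := by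
      calc ‖z - x‖ = ‖(x - x₀) + (x₀ - z)‖ := by rw [norm_sub_rev]; congr 1; abel
        _ ≤ ‖x - x₀‖ + ‖x₀ - z‖ := norm_add_le _ _
        _ ≤ _ := by linarith
    have h5 : δ ≤ ‖v‖ * (‖x₀ - z‖ + 1) := by
      calc δ ≤ ‖v‖ * ‖z - x‖ := by linarith
        _ ≤ _ := by gcongr
    have h6 : √(h (A x) + p x - (h (A x₀) + p x₀)) ≤ 1 := by
      exact Real.sqrt_le_one.2 (by linarith)
    calc _ ≤ δ / (‖x₀ - z‖ + 1) * 1 := by gcongr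
      _ ≤ ‖v‖ := by rw [mul_one, div_le_iff₀ (by positivity)]; exact h5

end Composite

/-! ### Local behaviour of the losses -/

section Losses

/-- Gradient inequality for strongly convex functions. -/
lemma strongConvexOn_gradient_le {Y : Type*} [NormedAddCommGroup Y] [InnerProductSpace ℝ Y]
    [CompleteSpace Y] {K : Set Y} {σ : ℝ} {f : Y → ℝ} (hf : StrongConvexOn K σ f) {y₀ y g : Y}
    (hy₀ : y₀ ∈ K) (hy : y ∈ K) (hg : HasGradientAt f g y₀) :
    f y₀ + inner ℝ g (y - y₀) + σ / 2 * ‖y - y₀‖ ^ 2 ≤ f y := by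
  have hlim := (hg.hasDerivAt_line (y - y₀)).tendsto_slope_zero_right
  have hR : Tendsto (fun t : ℝ => f y - f y₀ - (1 - t) * (σ / 2 * ‖y - y₀‖ ^ 2)) (𝓝[>] 0)
      (𝓝 (f y - f y₀ - (1 - 0) * (σ / 2 * ‖y - y₀‖ ^ 2))) := by
    have : Continuous (fun t : ℝ => f y - f y₀ - (1 - t) * (σ / 2 * ‖y - y₀‖ ^ 2)) := by fun_prop
    exact this.continuousAt.tendsto.mono_left nhdsWithin_le_nhds
  have := le_of_tendsto_of_tendsto hlim hR (by
    filter_upwards [Ioo_mem_nhdsGT (zero_lt_one' ℝ)] with t ht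
    have h1 := hf.2 hy₀ hy (sub_nonneg.2 ht.2.le) ht.1.le (by ring)
    rw [show (1 - t) • y₀ + t • y = y₀ + t • (y - y₀) by module, norm_sub_rev y₀ y] at h1
    simp only [smul_eq_mul] at h1
    rw [zero_add, zero_smul, add_zero, smul_eq_mul, ← div_eq_inv_mul, div_le_iff₀ ht.1]
    linarith)
  linarith

/-- No generators are needed: with `w = y₀` the cone is a point, and growth is strong convexity on a
closed ball inside the domain. -/
lemma IsLocallyStronglyConvexLoss.exists_hasConicGrowthAt {m : ℕ}
    {l : EuclideanSpace ℝ (Fin m) → EReal} (hl : IsLocallyStronglyConvexLoss l)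
    {y₀ : EuclideanSpace ℝ (Fin m)} (hy₀ : y₀ ∈ effDom l) :
    ∃ g, HasGradientAt (fun y => (l y).toReal) g y₀ ∧
      HasConicGrowthAt (effDom l) (fun y => (l y).toReal) y₀ g := by
  obtain ⟨-, -, -, hopen, hstrong, hdiff⟩ := hl
  have hd : DifferentiableAt ℝ (fun y => (l y).toReal) y₀ :=
    (hdiff.differentiableOn two_ne_zero).differentiableAt (hopen.mem_nhds hy₀)
  obtain ⟨ρ, hρ, hball⟩ := Metric.nhds_basis_closedBall.mem_iff.1 (hopen.mem_nhds hy₀)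
  obtain ⟨σ, hσ, hK⟩ := hstrong _ (isCompact_closedBall y₀ ρ) (convex_closedBall y₀ ρ) hball
  refine ⟨_, hd.hasGradientAt, 0, Fin.elim0, y₀, σ / 2, ρ, half_pos hσ, hρ,
    fun y _ hyρ => ⟨Fin.elim0, fun i => i.elim0, ?_⟩, fun _ _ => ?_⟩
  · have := strongConvexOn_gradient_le hK (Metric.mem_closedBall_self hρ.le)
      (mem_closedBall_iff_norm.2 hyρ) hd.hasGradientAt
    simp only [Finset.univ_eq_empty, Finset.sum_empty, sub_zero]
    linarith
  · simpa using hy₀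

/-- The gradient at `y₀` is the maximizer `g`. Strong convexity of `q` bounds the excess of `h`
above quadratically, which gives differentiability; the Lipschitz gradient bounds it below by the
squared distance to `∇q(g)` plus the normal cone at `g`. -/
lemma hasConicGrowthAt_of_isGreatest {Y : Type*} [NormedAddCommGroup Y] [InnerProductSpace ℝ Y]
    [CompleteSpace Y] {k : ℕ} (a : Fin k → Y) (β : Fin k → ℝ) {q h : Y → ℝ} {σ : ℝ} (hσ : 0 < σ)
    (hq : StrongConvexOn Set.univ σ q) (hdiff : Differentiable ℝ q) {L : NNReal}
    (hL : LipschitzWith L (gradient q))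
    (hh : ∀ y, IsGreatest ((fun u => inner ℝ y u - q u) '' {u | ∀ i, inner ℝ (a i) u ≤ β i}) (h y))
    (y₀ : Y) :
    ∃ g, HasGradientAt h g y₀ ∧ HasConicGrowthAt Set.univ h y₀ g := by
  classical
  obtain ⟨⟨g, hgD, hgy⟩, -⟩ := hh y₀
  have hge : ∀ y u, (∀ i, inner ℝ (a i) u ≤ β i) → inner ℝ y u - q u ≤ h y := fun y u hu =>
    (hh y).2 ⟨u, hu, rfl⟩
  dsimp only at hgy
  set w := gradient q g with hw
  have hgw : HasGradientAt q w g := (hdiff g).hasGradientAt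
  set b : Fin k → Y := fun i => if inner ℝ (a i) g = β i then a i else 0 with hb
  obtain ⟨ρ, hρ, hfeas⟩ := exists_feasible_radius a β hgD
  have hfeas' : ∀ d, ‖d‖ ≤ ρ → (∀ i, inner ℝ d (b i) ≤ 0) → ∀ i, inner ℝ (a i) (g + d) ≤ β i :=
    fun d hd hbd => hfeas d hd fun i hi => by
      have := hbd i
      rw [hb] at this
      dsimp only at this
      rwa [if_pos hi, real_inner_comm] at this
  have hlow : ∀ u, q g + inner ℝ w (u - g) + σ / 2 * ‖u - g‖ ^ 2 ≤ q u := fun u =>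
    strongConvexOn_gradient_le hq (Set.mem_univ _) (Set.mem_univ _) hgw
  have hupp : ∀ u, q u ≤ q g + inner ℝ w (u - g) + L * ‖u - g‖ ^ 2 := fun u => by
    have h1 := strongConvexOn_gradient_le hq (Set.mem_univ u) (Set.mem_univ g)
      (hdiff u).hasGradientAt
    have h2 : inner ℝ (gradient q u - w) (u - g) ≤ (L * ‖u - g‖) * ‖u - g‖ := by
      refine (real_inner_le_norm _ _).trans ?_
      gcongr
      exact hL.norm_sub_le u g
    have h3 : inner ℝ (gradient q u) (g - u) = - inner ℝ (gradient q u) (u - g) := by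
      rw [← inner_neg_right, neg_sub]
    rw [inner_sub_left] at h2
    have h4 : 0 ≤ σ / 2 * ‖g - u‖ ^ 2 := by positivity
    rw [h3] at h1
    linarith
  have hpolar : ∀ v ∈ coneGen b, ∀ u, (∀ i, inner ℝ (a i) u ≤ β i) → inner ℝ v (u - g) ≤ 0 := by
    rintro _ ⟨l, hl, rfl⟩ u hu
    rw [sum_inner]
    refine Finset.sum_nonpos fun i _ => ?_
    rw [real_inner_smul_left]
    refine mul_nonpos_of_nonneg_of_nonpos (hl i) ?_
    simp only [hb]
    split_ifs with hi
    · rw [inner_sub_right, hi]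
      linarith [hu i]
    · simp
  -- First-order optimality of `g`: no feasible direction improves, and Farkas gives conic
  -- coefficients.
  have hcone : y₀ - w ∈ coneGen b := by
    refine mem_coneGen_of_forall_inner b _ fun d hd => ?_
    have hlim := (hgw.hasDerivAt_line d).tendsto_slope_zero_right
    have hsmall : ∀ᶠ t : ℝ in 𝓝[>] 0, ‖t • d‖ < ρ := by
      have hc : ContinuousAt (fun t : ℝ => ‖t • d‖) 0 := by fun_prop
      exact (hc.eventually (Iio_mem_nhds (by simpa using hρ))).filter_mono nhdsWithin_le_nhds
    have := ge_of_tendsto hlim (b := inner ℝ y₀ d) (by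
      filter_upwards [hsmall, self_mem_nhdsWithin] with t ht ht0
      have ht0 : 0 < t := ht0
      have h1 := hge y₀ (g + t • d) (hfeas' _ ht.le fun i => by
        rw [real_inner_smul_left]
        exact mul_nonpos_of_nonneg_of_nonpos ht0.le (hd i))
      rw [inner_add_right, real_inner_smul_right] at h1
      rw [zero_add, zero_smul, add_zero, smul_eq_mul, ← div_eq_inv_mul, le_div_iff₀ ht0]
      linarith)
    rw [inner_sub_right, real_inner_comm, real_inner_comm w]
    linarith
  have hexc_nonneg : ∀ y, 0 ≤ h y - h y₀ - inner ℝ g (y - y₀) := fun y => by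
    have := hge y g hgD
    rw [inner_sub_right, real_inner_comm, real_inner_comm y₀]
    linarith
  have hexc_le : ∀ y, h y - h y₀ - inner ℝ g (y - y₀) ≤ 1 / (2 * σ) * ‖y - y₀‖ ^ 2 := fun y => by
    obtain ⟨⟨u, hu, huy⟩, -⟩ := hh y
    dsimp only at huy
    have h1 := hlow u
    have h2 := hpolar _ hcone u hu
    have h3 := real_inner_le_norm (y - y₀) (u - g)
    rw [real_inner_comm (y - y₀)]
    have e : h y - h y₀ - inner ℝ (y - y₀) g = inner ℝ (y - y₀) (u - g)
        + inner ℝ (y₀ - w) (u - g) + inner ℝ w (u - g) - (q u - q g) := by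
      rw [← huy, ← hgy]
      simp only [inner_sub_left, inner_sub_right]
      ring
    have h5 : ‖y - y₀‖ * ‖u - g‖ - σ / 2 * ‖u - g‖ ^ 2 ≤ 1 / (2 * σ) * ‖y - y₀‖ ^ 2 := by
      have h6 : 0 ≤ 1 / (2 * σ) * (‖y - y₀‖ - σ * ‖u - g‖) ^ 2 := by positivity
      have h7 : 1 / (2 * σ) * (‖y - y₀‖ - σ * ‖u - g‖) ^ 2 = 1 / (2 * σ) * ‖y - y₀‖ ^ 2
          - ‖y - y₀‖ * ‖u - g‖ + σ / 2 * ‖u - g‖ ^ 2 := by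
        field_simp
        ring
      linarith
    linarith
  -- The growth constant is `t / 2` for the step `t = 1 / (2 (L + 1))` used below.
  refine ⟨g, ?_, k, b, w, 1 / (4 * (L + 1)), ρ, by positivity, hρ, fun y _ hyρ => ?_,
    fun l hl => ⟨Set.mem_univ _, ?_⟩⟩
  · rw [hasGradientAt_iff_hasFDerivAt, hasFDerivAt_iff_isLittleO]
    refine Asymptotics.IsBigO.trans_isLittleO (g := fun y => ‖y - y₀‖ ^ 2) ?_
      (Asymptotics.isLittleO_pow_sub_sub y₀ one_lt_two)
    refine Asymptotics.IsBigO.of_bound (1 / (2 * σ)) (Eventually.of_forall fun y => ?_)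
    rw [InnerProductSpace.toDual_apply_apply, Real.norm_of_nonneg (hexc_nonneg y), norm_pow,
      norm_norm]
    exact hexc_le y
  · obtain ⟨l, hl, hlb, hl0⟩ := exists_proj_coneGen b (y - w)
    refine ⟨l, hl, ?_⟩
    set d := y - w - ∑ i, l i • b i with hd
    set t : ℝ := 1 / (2 * (L + 1)) with ht
    have ht0 : 0 < t := by positivity
    have ht1 : t ≤ 1 := by
      rw [ht, div_le_one (by positivity)]
      linarith [L.coe_nonneg]
    have htL : L * t ≤ 1 / 2 := by
      rw [ht, mul_one_div, div_le_iff₀ (by positivity)]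
      linarith [L.coe_nonneg]
    have hdd : inner ℝ d (y - w) = ‖d‖ ^ 2 := by
      rw [← real_inner_self_eq_norm_sq]
      calc inner ℝ d (y - w) = inner ℝ d (y - w - ∑ i, l i • b i) + inner ℝ d (∑ i, l i • b i) := by
            rw [← inner_add_right, sub_add_cancel]
        _ = inner ℝ d d := by rw [hl0, add_zero]
    -- Since `y₀ - w` is in the cone, the distance of `y - w` to the cone is at most `‖y - y₀‖`.
    have hdρ : ‖d‖ ≤ ρ := by
      refine le_trans ?_ hyρ
      have h1 : inner ℝ d (y₀ - w) ≤ 0 := by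
        obtain ⟨μ, hμ, hμe⟩ := hcone
        rw [hμe, inner_sum]
        refine Finset.sum_nonpos fun i _ => ?_
        rw [real_inner_smul_right]
        exact mul_nonpos_of_nonneg_of_nonpos (hμ i) (hlb i)
      have h2 : ‖d‖ * ‖d‖ ≤ ‖d‖ * ‖y - y₀‖ := by
        calc ‖d‖ * ‖d‖ = inner ℝ d (y - y₀) + inner ℝ d (y₀ - w) := by
              rw [← inner_add_right, sub_add_sub_cancel, hdd, sq]
          _ ≤ ‖d‖ * ‖y - y₀‖ := by linarith [real_inner_le_norm d (y - y₀)]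
      rcases (norm_nonneg d).eq_or_lt with h | h
      · rw [← h]
        exact norm_nonneg _
      · exact le_of_mul_le_mul_left h2 h
    have h1 := hge y (g + t • d) (hfeas' _ (by
        rw [norm_smul, Real.norm_of_nonneg ht0.le]
        nlinarith [norm_nonneg d]) fun i => by
      rw [real_inner_smul_left]
      exact mul_nonpos_of_nonneg_of_nonpos ht0.le (hlb i))
    -- The competitor `g + t • d` gains at least `t ‖d‖² - L t² ‖d‖²`, and `L t ≤ 1 / 2`.
    have h2 := hupp (g + t • d)
    rw [add_sub_cancel_left, norm_smul, Real.norm_of_nonneg ht0.le, real_inner_smul_right] at h2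
    rw [inner_add_right, real_inner_smul_right] at h1
    rw [inner_sub_right, real_inner_comm, real_inner_comm w] at hdd
    have e : inner ℝ g (y - y₀) = inner ℝ y g - inner ℝ y₀ g := by
      rw [inner_sub_right, real_inner_comm, real_inner_comm y₀]
    rw [e]
    have h3 : L * (t * ‖d‖) ^ 2 ≤ t / 2 * ‖d‖ ^ 2 := by
      calc L * (t * ‖d‖) ^ 2 = (L * t) * (t * ‖d‖ ^ 2) := by ring
        _ ≤ 1 / 2 * (t * ‖d‖ ^ 2) := by gcongr
        _ = _ := by ring
    have h4 : (1 : ℝ) / (4 * (L + 1)) = t / 2 := by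
      rw [ht]
      field_simp
      ring
    have h5 : t * inner ℝ y d - t * inner ℝ w d = t * ‖d‖ ^ 2 := by rw [← hdd]; ring
    rw [h4]
    linarith
  -- For `v` in the normal cone, `g` remains a maximizer at `w + v`, so the excess is not positive.
  · set v := ∑ i, l i • b i with hv
    obtain ⟨⟨u, hu, huy⟩, -⟩ := hh (w + v)
    dsimp only at huy
    have h1 := hlow u
    have h2 := hpolar v ⟨l, hl, rfl⟩ u hu
    have h3 : 0 ≤ σ / 2 * ‖u - g‖ ^ 2 := by positivity
    rw [← huy, ← hgy, real_inner_comm _ g]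
    simp only [inner_sub_left, inner_sub_right, inner_add_left] at h1 h2 ⊢
    linarith

lemma IsPolyhedralConjugateLoss.coe_toReal {m : ℕ} {l : EuclideanSpace ℝ (Fin m) → EReal}
    (hl : IsPolyhedralConjugateLoss l) (y : EuclideanSpace ℝ (Fin m)) :
    ((l y).toReal : EReal) = l y := by
  obtain ⟨D, q, -, -, -, -, h⟩ := hl
  obtain ⟨⟨u, -, hu⟩, -⟩ := h y
  rw [← hu]
  rfl

lemma IsPolyhedralConjugateLoss.exists_hasConicGrowthAt {m : ℕ}
    {l : EuclideanSpace ℝ (Fin m) → EReal} (hl : IsPolyhedralConjugateLoss l)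
    (y₀ : EuclideanSpace ℝ (Fin m)) :
    ∃ g, HasGradientAt (fun y => (l y).toReal) g y₀ ∧
      HasConicGrowthAt Set.univ (fun y => (l y).toReal) y₀ g := by
  have hfin := hl.coe_toReal
  obtain ⟨_, q, ⟨k, φ, β, rfl⟩, ⟨σ, hσ, hq⟩, hdiff, ⟨L, hL⟩, h⟩ := hl
  let a : Fin k → EuclideanSpace ℝ (Fin m) := fun i =>
    (InnerProductSpace.toDual ℝ _).symm (LinearMap.toContinuousLinearMap (φ i))
  have ha : ∀ i u, φ i u = inner ℝ (a i) u := fun i u => by simp [a]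
  simp only [ha] at h
  refine hasConicGrowthAt_of_isGreatest a β hσ hq hdiff hL (fun y => ?_) y₀
  obtain ⟨⟨u, hu, huy⟩, hmax⟩ := h y
  rw [← hfin y] at huy hmax
  refine ⟨⟨u, hu, EReal.coe_eq_coe_iff.1 huy⟩, ?_⟩
  rintro _ ⟨u', hu', rfl⟩
  exact EReal.coe_le_coe_iff.1 (hmax ⟨u', hu', rfl⟩)

end Losses

/-! ### Extended-real-valued convex functions -/

section ExtendedReal

lemma coe_toReal_of_mem_effDom {E : Type*} {f : E → EReal} (hf : ∀ x, f x ≠ ⊥) {x : E}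
    (hx : x ∈ effDom f) : ((f x).toReal : EReal) = f x :=
  EReal.coe_toReal (ne_of_lt hx) (hf x)

lemma realEpigraph_effDom {E : Type*} {f : E → EReal} (hf : ∀ x, f x ≠ ⊥) :
    realEpigraph (effDom f) (fun x => (f x).toReal) = epigraph f := by
  ext ⟨x, s⟩
  constructor
  · rintro ⟨hx, hs⟩
    change f x ≤ s
    rw [← coe_toReal_of_mem_effDom hf hx]
    exact EReal.coe_le_coe_iff.2 hs
  · intro (h : f x ≤ s)
    have hx : x ∈ effDom f := h.trans_lt (EReal.coe_lt_top s)
    refine ⟨hx, ?_⟩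
    rw [← coe_toReal_of_mem_effDom hf hx] at h
    exact EReal.coe_le_coe_iff.1 h

lemma convexOn_toReal {E : Type*} [AddCommGroup E] [Module ℝ E] {f : E → EReal}
    (hf : ∀ x, f x ≠ ⊥) (hconv : IsConvexFun f) : ConvexOn ℝ (effDom f) (fun x => (f x).toReal) :=
  convexOn_of_convex_realEpigraph (by rw [realEpigraph_effDom hf]; exact hconv)

lemma lowerSemicontinuous_of_isLeast {E ι : Type*} [TopologicalSpace E] [Finite ι]
    {F : ι → E → EReal} {f : E → EReal} (hF : ∀ i, LowerSemicontinuous (F i))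
    (hf : ∀ x, IsLeast (Set.range fun i => F i x) (f x)) : LowerSemicontinuous f := by
  intro x y hy
  have : ∀ᶠ z in 𝓝 x, ∀ i, y < F i z :=
    eventually_all.2 fun i => hF i x y (hy.trans_le ((hf x).2 ⟨i, rfl⟩))
  filter_upwards [this] with z hz
  obtain ⟨i, hi⟩ := (hf z).1
  rw [← hi]
  exact hz i

variable {E : Type*} [NormedAddCommGroup E] [InnerProductSpace ℝ E]

/-- A regular subgradient of `f` at `x` is a convex subgradient of every convex majorant of `f`
which agrees with `f` at `x`. -/
lemma regularSubdiff_le_of_convex_majorant {f : E → EReal} {x v : E} (hv : v ∈ regularSubdiff f x)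
    {C : Set E} {F : E → ℝ} (hF : ConvexOn ℝ C F) (hxC : x ∈ C) (hx : f x = F x)
    (hle : ∀ z ∈ C, f z ≤ F z) {z : E} (hz : z ∈ C) : F x + inner ℝ v (z - x) ≤ F z := by
  rcases eq_or_ne z x with rfl | hne
  · simp
  have hzx : 0 < ‖z - x‖ := norm_pos_iff.2 (sub_ne_zero.2 hne)
  by_contra! hcon
  -- By convexity, a violation at `z` persists along the segment to `x` with difference quotient at
  -- most `-η`, against the liminf condition.
  set η := (F x + inner ℝ v (z - x) - F z) / ‖z - x‖ with hη
  have hη0 : 0 < η := div_pos (by linarith) hzx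
  have hev := eventually_lt_of_lt_liminf
    (lt_of_lt_of_le (EReal.coe_neg'.2 (neg_lt_zero.2 hη0)) hv.2)
  have htend : Tendsto (fun t : ℝ => x + t • (z - x)) (𝓝[>] 0) (𝓝[≠] x) := by
    refine tendsto_nhdsWithin_iff.2 ⟨?_, ?_⟩
    · have hc : ContinuousAt (fun t : ℝ => x + t • (z - x)) 0 := by fun_prop
      simpa using hc.tendsto.mono_left (nhdsWithin_le_nhds (s := Set.Ioi 0))
    · filter_upwards [self_mem_nhdsWithin] with t ht
      have ht : 0 < t := ht
      simpa [sub_eq_zero, ht.ne'] using hne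
  obtain ⟨t, ht, ht01⟩ := ((htend.eventually hev).and (Ioo_mem_nhdsGT (zero_lt_one' ℝ))).exists
  have ht0 : 0 < t := ht01.1
  have hcomb : (1 - t) • x + t • z = x + t • (z - x) := by module
  have hmem := hF.1 hxC hz (sub_nonneg.2 ht01.2.le) ht0.le (by ring)
  have hval := hF.2 hxC hz (sub_nonneg.2 ht01.2.le) ht0.le (by ring)
  rw [hcomb] at hmem hval
  simp only [smul_eq_mul] at hval
  have hlt := ht.trans_le (EReal.div_le_div_right_of_nonneg
    (EReal.coe_nonneg.2 (norm_nonneg (x + t • (z - x) - x)))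
    (EReal.sub_le_sub (EReal.sub_le_sub (hle _ hmem) le_rfl) le_rfl))
  rw [hx, ← EReal.coe_sub, ← EReal.coe_sub, ← EReal.coe_div, EReal.coe_lt_coe_iff,
    add_sub_cancel_left, norm_smul, Real.norm_of_nonneg ht0.le, real_inner_smul_right,
    lt_div_iff₀ (by positivity)] at hlt
  have h1 : -η * (t * ‖z - x‖) = - (t * (F x + inner ℝ v (z - x) - F z)) := by
    rw [hη]
    field_simp
  rw [h1] at hlt
  linarith

/-- A limiting subgradient of a finite minimum of convex functions is a convex subgradient of one
of the functions attaining the minimum. -/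
lemma exists_subgradient_of_mem_limitingSubdiff {ι : Type*} [Finite ι] {F : ι → E → EReal}
    {f : E → EReal} (hbot : ∀ i x, F i x ≠ ⊥) (hlsc : ∀ i, LowerSemicontinuous (F i))
    (hconv : ∀ i, ConvexOn ℝ (effDom (F i)) fun x => (F i x).toReal)
    (hf : ∀ x, IsLeast (Set.range fun i => F i x) (f x)) {x v : E}
    (hv : v ∈ limitingSubdiff f x) :
    ∃ i, F i x = f x ∧ ∀ z ∈ effDom (F i),
      (F i x).toReal + inner ℝ v (z - x) ≤ (F i z).toReal := by
  obtain ⟨hx, xs, vs, hxs, hfxs, hvs, hreg⟩ := hv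
  choose j hj using fun t => (hf (xs t)).1
  obtain ⟨i, hi⟩ : ∃ i, ∃ᶠ t in atTop, j t = i := by
    by_contra! h
    obtain ⟨t, ht⟩ := (eventually_all.2 h).exists
    exact ht _ rfl
  obtain ⟨φ, hφ, hji⟩ := extraction_of_frequently_atTop hi
  have hφt := hφ.tendsto_atTop
  have hxs' := hxs.comp hφt
  have hfxs' := hfxs.comp hφt
  have hvs' := hvs.comp hφt
  have hFi : ∀ t, F i (xs (φ t)) = f (xs (φ t)) := fun t => by
    rw [← hj, hji]
  -- Lower semicontinuity of `F i` keeps the recurring piece active in the limit, as `f` converges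
  -- along the sequence.
  have hFx : F i x = f x := by
    refine le_antisymm ?_ ((hf x).2 ⟨i, rfl⟩)
    by_contra! hlt
    obtain ⟨c, hc1, hc2⟩ := exists_between hlt
    obtain ⟨t, ht1, ht2⟩ := ((hfxs'.eventually_lt_const hc1).and
      (hxs'.eventually (hlsc i x c hc2))).exists
    simp only [Function.comp_apply] at ht1 ht2
    rw [hFi] at ht2
    exact lt_asymm ht1 ht2
  refine ⟨i, hFx, fun z hz => ?_⟩
  have hineq : ∀ t, (f (xs (φ t))).toReal + inner ℝ (vs (φ t)) (z - xs (φ t))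
      ≤ (F i z).toReal := fun t => by
    have hdom : xs (φ t) ∈ effDom (F i) := by
      change F i _ < ⊤
      rw [hFi]
      exact (hreg (φ t)).1
    rw [← hFi]
    refine regularSubdiff_le_of_convex_majorant (hreg (φ t)) (hconv i) hdom ?_ (fun y hy => ?_) hz
    · rw [coe_toReal_of_mem_effDom (hbot i) hdom, hFi]
    · rw [coe_toReal_of_mem_effDom (hbot i) hy]
      exact (hf y).2 ⟨i, rfl⟩
  have hbx : f x ≠ ⊥ := hFx ▸ hbot i x
  rw [hFx]
  have hl1 : Tendsto (fun t => (f (xs (φ t))).toReal) atTop (𝓝 (f x).toReal) :=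
    (EReal.tendsto_toReal hx.ne hbx).comp hfxs'
  have hl2 : Tendsto (fun t => (inner ℝ (vs (φ t)) (z - xs (φ t)) : ℝ)) atTop
      (𝓝 (inner ℝ v (z - x))) := hvs'.inner (tendsto_const_nhds.sub hxs')
  exact le_of_tendsto' (hl1.add hl2) hineq

end ExtendedReal

/-! ### The general result -/

section General

/-- What the general result needs from a loss. -/
structure IsAdmissibleLoss {m : ℕ} (l : EuclideanSpace ℝ (Fin m) → EReal) : Prop where
  ne_bot : ∀ y, l y ≠ ⊥
  lsc : LowerSemicontinuous l
  isOpen : IsOpen (effDom l)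
  convexOn : ConvexOn ℝ (effDom l) fun y => (l y).toReal
  growth : ∀ y₀ ∈ effDom l, ∃ g, HasGradientAt (fun y => (l y).toReal) g y₀ ∧
    HasConicGrowthAt (effDom l) (fun y => (l y).toReal) y₀ g

lemma IsLocallyStronglyConvexLoss.isAdmissibleLoss {m : ℕ} {l : EuclideanSpace ℝ (Fin m) → EReal}
    (hl : IsLocallyStronglyConvexLoss l) : IsAdmissibleLoss l where
  ne_bot := hl.1.1
  lsc := hl.2.1
  isOpen := hl.2.2.2.1
  convexOn := convexOn_toReal hl.1.1 hl.2.2.1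
  growth := fun _ hy => hl.exists_hasConicGrowthAt hy

lemma IsPolyhedralConjugateLoss.isAdmissibleLoss {m : ℕ} {l : EuclideanSpace ℝ (Fin m) → EReal}
    (hl : IsPolyhedralConjugateLoss l) : IsAdmissibleLoss l := by
  have hcoe := hl.coe_toReal
  have hdom : effDom l = Set.univ := Set.eq_univ_of_forall fun y => by
    change l y < ⊤
    rw [← hcoe]
    exact EReal.coe_lt_top _
  have hgrow := hl.exists_hasConicGrowthAt
  refine ⟨fun y => ?_, ?_, ?_, ?_, ?_⟩
  · rw [← hcoe]
    exact EReal.coe_ne_bot _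
  · have hc : Continuous fun y => (l y).toReal := continuous_iff_continuousAt.2 fun y => by
      obtain ⟨g, hg, -⟩ := hgrow y
      exact hg.continuousAt
    have : l = fun y => ((l y).toReal : EReal) := funext fun y => (hcoe y).symm
    rw [this]
    exact (continuous_coe_real_ereal.comp hc).lowerSemicontinuous
  · rw [hdom]
    exact isOpen_univ
  · obtain ⟨D, q, -, -, -, -, h⟩ := hl
    rw [hdom]
    refine ⟨convex_univ, fun y _ z _ s t hs ht hst => ?_⟩
    obtain ⟨u, huD, hu⟩ := (h (s • y + t • z)).1
    have hy := (h y).2 ⟨u, huD, rfl⟩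
    have hz := (h z).2 ⟨u, huD, rfl⟩
    rw [← hcoe, EReal.coe_le_coe_iff] at hy hz
    rw [← hcoe] at hu
    dsimp only
    rw [← EReal.coe_eq_coe_iff.1 hu, inner_add_left, real_inner_smul_left, real_inner_smul_left,
      smul_eq_mul, smul_eq_mul]
    calc _ = s * (inner ℝ y u - q u) + t * (inner ℝ z u - q u) := by
          rw [show t = 1 - s by linarith]
          ring
      _ ≤ _ := by gcongr
  · rw [hdom]
    exact fun y _ => hgrow y

lemma isAdmissibleLoss_of_or {m : ℕ} {l : EuclideanSpace ℝ (Fin m) → EReal}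
    (hl : IsLocallyStronglyConvexLoss l ∨ IsPolyhedralConjugateLoss l) : IsAdmissibleLoss l :=
  hl.elim (·.isAdmissibleLoss) (·.isAdmissibleLoss)

variable {m : ℕ} {l : EuclideanSpace ℝ (Fin m) → EReal}
  {E : Type*} [NormedAddCommGroup E] [InnerProductSpace ℝ E]

lemma IsAdmissibleLoss.lowerSemicontinuous_add [FiniteDimensional ℝ E] (hl : IsAdmissibleLoss l)
    (A : E →ₗ[ℝ] EuclideanSpace ℝ (Fin m)) {P : E → EReal} (hbot : ∀ x, P x ≠ ⊥)
    (hP : LowerSemicontinuous P) : LowerSemicontinuous fun x => l (A x) + P x := by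
  have h1 : LowerSemicontinuous fun x => l (A x) := fun x y hy =>
    (LinearMap.continuous_of_finiteDimensional A).continuousAt.eventually (hl.lsc (A x) y hy)
  exact h1.add' hP fun x => EReal.continuousAt_add (Or.inr (hbot x)) (Or.inl (hl.ne_bot _))

lemma IsAdmissibleLoss.effDom_add (hl : IsAdmissibleLoss l)
    (A : E →ₗ[ℝ] EuclideanSpace ℝ (Fin m)) {P : E → EReal} (hbot : ∀ x, P x ≠ ⊥) :
    effDom (fun x => l (A x) + P x) = {x | x ∈ effDom P ∧ A x ∈ effDom l} := by
  ext x
  change l (A x) + P x < ⊤ ↔ P x < ⊤ ∧ l (A x) < ⊤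
  rw [lt_top_iff_ne_top, EReal.add_ne_top_iff_ne_top₂ (hl.ne_bot _) (hbot x), and_comm,
    lt_top_iff_ne_top, lt_top_iff_ne_top]

lemma IsAdmissibleLoss.toReal_add (hl : IsAdmissibleLoss l)
    (A : E →ₗ[ℝ] EuclideanSpace ℝ (Fin m)) {P : E → EReal} (hbot : ∀ x, P x ≠ ⊥) {x : E}
    (hxP : x ∈ effDom P) (hxl : A x ∈ effDom l) :
    (l (A x) + P x).toReal = (l (A x)).toReal + (P x).toReal :=
  EReal.toReal_add (ne_of_lt hxl) (hl.ne_bot _) (ne_of_lt hxP) (hbot x)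

lemma IsAdmissibleLoss.convexOn_add (hl : IsAdmissibleLoss l)
    (A : E →ₗ[ℝ] EuclideanSpace ℝ (Fin m)) {P : E → EReal} (hbot : ∀ x, P x ≠ ⊥)
    (hP : ConvexOn ℝ (effDom P) fun x => (P x).toReal) :
    ConvexOn ℝ (effDom fun x => l (A x) + P x) fun x => (l (A x) + P x).toReal := by
  rw [hl.effDom_add A hbot]
  have h1 := hl.convexOn.comp_linearMap A
  have hconv : Convex ℝ {x | x ∈ effDom P ∧ A x ∈ effDom l} := hP.1.inter h1.1
  have h2 := (h1.subset (fun x hx => hx.2) hconv).add (hP.subset (fun x hx => hx.1) hconv)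
  exact h2.congr fun x hx => (hl.toReal_add A hbot hx.1 hx.2).symm

variable [FiniteDimensional ℝ E]

/-- The Kurdyka–Łojasiewicz inequality for one polyhedral piece, near a point where the piece need
not attain the minimum. -/
lemma IsAdmissibleLoss.exists_kl_inequality_piece (hl : IsAdmissibleLoss l)
    (A : E →ₗ[ℝ] EuclideanSpace ℝ (Fin m)) {P : E → EReal} (hbot : ∀ x, P x ≠ ⊥)
    (hlsc : LowerSemicontinuous P) (hpoly : IsPolyhedralFun P) {x₀ : E} {r : ℝ}
    (hr : (r : EReal) ≤ l (A x₀) + P x₀) :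
    ∃ c ε ν : ℝ, 0 < c ∧ 0 < ε ∧ 0 < ν ∧ ∀ x, ‖x - x₀‖ ≤ ε →
      (r : EReal) < l (A x) + P x → l (A x) + P x < ((r + ν : ℝ) : EReal) →
      ∀ v : E, (∀ z ∈ effDom (fun x => l (A x) + P x),
          (l (A x) + P x).toReal + inner ℝ v (z - x) ≤ (l (A z) + P z).toReal) →
        c * ((l (A x) + P x).toReal - r) ^ (1 / 2 : ℝ) ≤ ‖v‖ := by
  rcases hr.eq_or_lt with hr | hr
  · have hx₀ : x₀ ∈ effDom (fun x => l (A x) + P x) := by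
      change l (A x₀) + P x₀ < ⊤
      rw [← hr]
      exact EReal.coe_lt_top _
    rw [hl.effDom_add A hbot] at hx₀ ⊢
    obtain ⟨g, hg, hgrow⟩ := hl.growth _ hx₀.2
    obtain ⟨c, ε, ν, hc, hε, hν, H⟩ := exists_kl_inequality
      (C := effDom P) (p := fun x => (P x).toReal) (by rw [realEpigraph_effDom hbot]; exact hpoly) A
      hx₀.1 (hl.isOpen.mem_nhds hx₀.2) hg hgrow
    have hr' : r = (l (A x₀)).toReal + (P x₀).toReal := by
      rw [← hl.toReal_add A hbot hx₀.1 hx₀.2, ← hr]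
      rfl
    refine ⟨c, ε, ν, hc, hε, hν, fun x hxε hlt hltν v hv => ?_⟩
    have hx : x ∈ effDom (fun x => l (A x) + P x) := hltν.trans (EReal.coe_lt_top _)
    rw [← coe_toReal_of_mem_effDom (f := fun x => l (A x) + P x)
      (fun x => EReal.add_ne_bot_iff.2 ⟨hl.ne_bot _, hbot _⟩) hx, EReal.coe_lt_coe_iff] at hlt hltν
    rw [hl.effDom_add A hbot] at hx
    rw [hl.toReal_add A hbot hx.1 hx.2, hr'] at hlt hltν
    rw [hl.toReal_add A hbot hx.1 hx.2, hr']
    refine H x hx.1 hx.2 hxε hlt hltν v fun z hzP hzl => ?_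
    have := hv z ⟨hzP, hzl⟩
    rwa [hl.toReal_add A hbot hx.1 hx.2, hl.toReal_add A hbot hzP hzl] at this
  -- An inactive piece stays above `s = r + ν` near `x₀`, so the claim is vacuous.
  · obtain ⟨s, hrs, hs⟩ := EReal.lt_iff_exists_real_btwn.1 hr
    obtain ⟨ε, hε, hball⟩ := Metric.eventually_nhds_iff.1
      (hl.lowerSemicontinuous_add A hbot hlsc x₀ s hs)
    refine ⟨1, ε / 2, s - r, one_pos, half_pos hε, sub_pos.2 (EReal.coe_lt_coe_iff.1 hrs),
      fun x hxε _ hlt => ?_⟩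
    rw [add_sub_cancel] at hlt
    exact absurd (hball (by rw [dist_eq_norm]; linarith)) (not_lt.2 hlt.le)

/-- The sum of an admissible loss composed with a linear map and a finite minimum of proper closed
polyhedral functions is a KL function with exponent `1/2`. -/
theorem IsAdmissibleLoss.isKLFunctionWithExponent {ι : Type*} [Finite ι] (hl : IsAdmissibleLoss l)
    (A : E →ₗ[ℝ] EuclideanSpace ℝ (Fin m)) {P : ι → E → EReal} (hbot : ∀ i x, P i x ≠ ⊥)
    (hlsc : ∀ i, LowerSemicontinuous (P i)) (hpoly : ∀ i, IsPolyhedralFun (P i))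
    {f : E → EReal} (hf : ∀ x, f x = l (A x) + ⨅ i, P i x) (hprop : IsProper f) :
    IsKLFunctionWithExponent f (1 / 2) := by
  have hι : Nonempty ι := by
    by_contra h
    rw [not_nonempty_iff] at h
    obtain ⟨x, hx⟩ := hprop.2
    change f x < ⊤ at hx
    rw [hf, iInf_of_empty, EReal.add_top_of_ne_bot (hl.ne_bot _)] at hx
    exact lt_irrefl _ hx
  have hleast : ∀ x, IsLeast (Set.range fun i => l (A x) + P i x) (f x) := fun x => by
    obtain ⟨i, hi⟩ := exists_eq_ciInf_of_finite (f := fun i => P i x)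
    refine ⟨⟨i, ?_⟩, ?_⟩
    · dsimp only at hi ⊢
      rw [hf, hi]
    · rintro _ ⟨i, rfl⟩
      rw [hf]
      exact add_le_add_right (iInf_le _ i) _
  have hlscF := fun i => hl.lowerSemicontinuous_add A (hbot i) (hlsc i)
  refine ⟨hprop, lowerSemicontinuous_of_isLeast hlscF hleast, fun x₀ hx₀ => ?_⟩
  obtain ⟨v₀, hv₀⟩ := hx₀
  have hfx₀ : ((f x₀).toReal : EReal) = f x₀ := coe_toReal_of_mem_effDom hprop.1 hv₀.1
  choose c ε ν hc hε hν H using fun i => hl.exists_kl_inequality_piece A (hbot i) (hlsc i)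
    (hpoly i) (x₀ := x₀) (r := (f x₀).toReal) (by rw [hfx₀]; exact (hleast x₀).2 ⟨i, rfl⟩)
  obtain ⟨i₁, hi₁⟩ := Finite.exists_min c
  obtain ⟨i₂, hi₂⟩ := Finite.exists_min ε
  obtain ⟨i₃, hi₃⟩ := Finite.exists_min ν
  refine ⟨c i₁, ε i₂, (ν i₃ : EReal), hc _, hε _, EReal.coe_pos.2 (hν _), fun x hxε hlt hltν => ?_⟩
  refine Metric.le_infEDist.2 fun v hv => ?_
  rw [edist_comm, edist_zero_right, ← ofReal_norm]
  refine ENNReal.ofReal_le_ofReal ?_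
  obtain ⟨i, hi, hsub⟩ := exists_subgradient_of_mem_limitingSubdiff
    (fun i x => EReal.add_ne_bot_iff.2 ⟨hl.ne_bot _, hbot i x⟩) hlscF
    (fun i => hl.convexOn_add A (hbot i) (convexOn_toReal (hbot i) (hpoly i).convex)) hleast hv
  have h1 := H i x (hxε.trans (hi₂ i)) (by rw [hi, hfx₀]; exact hlt) (by
    rw [hi]
    refine hltν.trans_le ?_
    rw [← hfx₀, ← EReal.coe_add, EReal.coe_le_coe_iff, EReal.toReal_coe]
    linarith [hi₃ i]) v hsub
  rw [hi] at h1
  refine le_trans ?_ h1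
  have h2 : 0 ≤ (f x).toReal - (f x₀).toReal := by
    rw [sub_nonneg]
    exact EReal.toReal_le_toReal hlt.le (hprop.1 _) hv.1.ne
  have h3 : 0 ≤ ((f x).toReal - (f x₀).toReal) ^ (1 / 2 : ℝ) := Real.rpow_nonneg h2 _
  gcongr
  exact hi₁ i

end General

/-! ### The standard losses -/

section StandardLosses

lemma exists_pos_forall_le {ι : Type*} [Finite ι] {c : ι → ℝ} (hc : ∀ i, 0 < c i) :
    ∃ σ : ℝ, 0 < σ ∧ ∀ i, σ ≤ c i := by
  cases isEmpty_or_nonempty ι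
  · exact ⟨1, one_pos, fun i => isEmptyElim i⟩
  · obtain ⟨i, hi⟩ := Finite.exists_min c
    exact ⟨c i, hc i, hi⟩

lemma isLocallyStronglyConvexLoss_coe {m : ℕ} {g : EuclideanSpace ℝ (Fin m) → ℝ}
    (hg : ContDiff ℝ 2 g)
    (hstrong : ∀ K : Set (EuclideanSpace ℝ (Fin m)), IsCompact K → Convex ℝ K →
      ∃ σ : ℝ, 0 < σ ∧ StrongConvexOn K σ g) :
    IsLocallyStronglyConvexLoss fun y => (g y : EReal) := by
  have hdom : effDom (fun y => (g y : EReal)) = Set.univ :=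
    Set.eq_univ_of_forall fun y => EReal.coe_lt_top _
  have hconv : ConvexOn ℝ Set.univ g := by
    refine ⟨convex_univ, fun x _ y _ a b ha hb hab => ?_⟩
    -- Convexity concerns two points at a time, so a ball containing both suffices.
    obtain ⟨σ, hσ, hK⟩ := hstrong (Metric.closedBall 0 (max ‖x‖ ‖y‖)) (isCompact_closedBall _ _)
      (convex_closedBall _ _)
    have hK' : ConvexOn ℝ _ g := UniformConvexOn.convexOn hK fun r => by
      dsimp only [Pi.zero_apply]
      positivity
    exact hK'.2 (by simp) (by simp) ha hb hab
  refine ⟨⟨fun y => EReal.coe_ne_bot _, 0, EReal.coe_lt_top _⟩,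
    (continuous_coe_real_ereal.comp hg.continuous).lowerSemicontinuous, ?_, ?_, fun K hK hKc _ => ?_,
    ?_⟩
  · have h := hconv.convex_epigraph
    have e : epigraph (fun y => (g y : EReal)) = {p | p.1 ∈ Set.univ ∧ g p.1 ≤ p.2} := by
      ext p
      exact ⟨fun h => ⟨trivial, EReal.coe_le_coe_iff.1 h⟩, fun h => EReal.coe_le_coe_iff.2 h.2⟩
    rw [IsConvexFun, e]
    exact h
  · rw [hdom]
    exact isOpen_univ
  · exact hstrong K hK hKc
  · exact hg.contDiffOn

/-- The second derivative of the logistic term has a positive lower bound on a bounded interval.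
Allowing every `σ ≤ σ₀` lets all coordinates share one modulus. -/
lemma exists_convexOn_log_one_add_exp_sub_sq {b : ℝ} (hb : b ≠ 0) (R : ℝ) :
    ∃ σ₀ : ℝ, 0 < σ₀ ∧ ∀ σ ≤ σ₀,
      ConvexOn ℝ (Set.Icc (-R) R) fun t => Real.log (1 + Real.exp (b * t)) - σ / 2 * t ^ 2 := by
  set M := |b| * R with hM
  refine ⟨b ^ 2 * (Real.exp (-M) / (1 + Real.exp M) ^ 2), by positivity, fun σ hσ => ?_⟩
  have h1 : ∀ t : ℝ, HasDerivAt (fun t => Real.log (1 + Real.exp (b * t)) - σ / 2 * t ^ 2)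
      (Real.exp (b * t) * b / (1 + Real.exp (b * t)) - σ * t) t := fun t => by
    have e1 : HasDerivAt (fun t => Real.exp (b * t)) (Real.exp (b * t) * b) t := by
      simpa using ((hasDerivAt_id t).const_mul b).exp
    have e2 := (e1.const_add 1).log (by positivity)
    have e3 := (hasDerivAt_pow 2 t).const_mul (σ / 2)
    refine (e2.sub e3).congr_deriv ?_
    norm_num
    ring
  have h2 : ∀ t : ℝ, HasDerivAt (fun t => Real.exp (b * t) * b / (1 + Real.exp (b * t)) - σ * t)
      (b ^ 2 * (Real.exp (b * t) / (1 + Real.exp (b * t)) ^ 2) - σ) t := fun t => by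
    have e1 : HasDerivAt (fun t => Real.exp (b * t)) (Real.exp (b * t) * b) t := by
      simpa using ((hasDerivAt_id t).const_mul b).exp
    have e2 := (e1.mul_const b).div (e1.const_add 1) (by positivity)
    have e3 := (hasDerivAt_id t).const_mul σ
    refine (e2.sub e3).congr_deriv ?_
    field_simp
    ring
  refine convexOn_of_hasDerivWithinAt2_nonneg (convex_Icc _ _)
    (fun t _ => (h1 t).continuousAt.continuousWithinAt) (fun t _ => (h1 t).hasDerivWithinAt)
    (fun t _ => (h2 t).hasDerivWithinAt) fun t ht => ?_
  have htR : |t| ≤ R := abs_le.2 (Set.mem_Icc.1 (interior_subset ht))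
  have hbt : |b * t| ≤ M := by
    rw [abs_mul]
    exact mul_le_mul_of_nonneg_left htR (abs_nonneg b)
  have h3 : Real.exp (-M) / (1 + Real.exp M) ^ 2
      ≤ Real.exp (b * t) / (1 + Real.exp (b * t)) ^ 2 := by
    have := abs_le.1 hbt
    gcongr
    · exact this.1
    · exact this.2
  have := mul_le_mul_of_nonneg_left h3 (sq_nonneg b)
  linarith

theorem isLocallyStronglyConvexLoss_logisticLoss {m : ℕ} {b : Fin m → ℝ} (hb : ∀ i, b i ≠ 0) :
    IsLocallyStronglyConvexLoss (logisticLoss b) := by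
  refine isLocallyStronglyConvexLoss_coe ?_ fun K hK hKc => ?_
  · refine ContDiff.sum fun i _ => ContDiff.log ?_ fun y => by positivity
    fun_prop
  · obtain ⟨R, hR⟩ := hK.isBounded.exists_norm_le
    choose c hc0 hc using fun i => exists_convexOn_log_one_add_exp_sub_sq (hb i) R
    obtain ⟨σ, hσ, hσc⟩ := exists_pos_forall_le hc0
    refine ⟨σ, hσ, strongConvexOn_iff_convex.2 ⟨hKc, fun x hx y hy s t hs ht hst => ?_⟩⟩
    have e : ∀ z : EuclideanSpace ℝ (Fin m),
        ∑ i, Real.log (1 + Real.exp (b i * z i)) - σ / 2 * ‖z‖ ^ 2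
          = ∑ i, (Real.log (1 + Real.exp (b i * z i)) - σ / 2 * z i ^ 2) := fun z => by
      rw [EuclideanSpace.real_norm_sq_eq, Finset.mul_sum, Finset.sum_sub_distrib]
    have hmem : ∀ z ∈ K, ∀ i, z i ∈ Set.Icc (-R) R := fun z hz i =>
      abs_le.1 ((PiLp.norm_apply_le z i).trans (hR z hz))
    dsimp only
    rw [e, e, e, Finset.smul_sum, Finset.smul_sum, ← Finset.sum_add_distrib]
    exact Finset.sum_le_sum fun i _ =>
      (hc i σ (hσc i)).2 (hmem x hx i) (hmem y hy i) hs ht hst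

theorem isLocallyStronglyConvexLoss_leastSquaresLoss {m : ℕ} (b : EuclideanSpace ℝ (Fin m)) :
    IsLocallyStronglyConvexLoss (leastSquaresLoss b) := by
  refine isLocallyStronglyConvexLoss_coe ?_ fun K hK hKc => ⟨1, one_pos, ?_⟩
  · exact ((contDiff_id.sub contDiff_const).norm_sq ℝ).div_const 2
  · refine strongConvexOn_iff_convex.2 ⟨hKc, fun x hx y hy s t hs ht hst => le_of_eq ?_⟩
    have e : ∀ z : EuclideanSpace ℝ (Fin m),
        ‖z - b‖ ^ 2 / 2 - 1 / 2 * ‖z‖ ^ 2 = ‖b‖ ^ 2 / 2 - inner ℝ z b := fun z => by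
      rw [norm_sub_sq_real]
      ring
    dsimp only
    rw [e, e, e, inner_add_left, real_inner_smul_left, real_inner_smul_left, smul_eq_mul,
      smul_eq_mul, show t = 1 - s by linarith]
    ring

end StandardLosses

/-! ### Polyhedra and polyhedral functions -/

section PolyhedralFunctions

variable {V : Type*} [AddCommGroup V] [Module ℝ V]

lemma isPolyhedron_iInter_halfspace {ι : Type*} [Finite ι] (φ : ι → V →ₗ[ℝ] ℝ) (β : ι → ℝ) :
    IsPolyhedron {v | ∀ i, φ i v ≤ β i} := by
  obtain ⟨k, ⟨e⟩⟩ := Finite.exists_equiv_fin ι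
  refine ⟨k, fun i => φ (e.symm i), fun i => β (e.symm i), ?_⟩
  ext v
  exact (e.symm.forall_congr_right (q := fun i => φ i v ≤ β i)).symm

lemma isPolyhedron_halfspace (φ : V →ₗ[ℝ] ℝ) (β : ℝ) : IsPolyhedron {v | φ v ≤ β} := by
  simpa using isPolyhedron_iInter_halfspace (fun _ : Unit => φ) (fun _ => β)

lemma isPolyhedron_iInter {ι : Type*} [Finite ι] {S : ι → Set V} (hS : ∀ i, IsPolyhedron (S i)) :
    IsPolyhedron (⋂ i, S i) := by
  choose k φ β hS using hS
  have := isPolyhedron_iInter_halfspace (fun j : Σ i, Fin (k i) => φ j.1 j.2) (fun j => β j.1 j.2)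
  convert this using 1
  ext v
  simp [hS, Sigma.forall]

lemma IsPolyhedron.inter {S T : Set V} (hS : IsPolyhedron S) (hT : IsPolyhedron T) :
    IsPolyhedron (S ∩ T) := by
  rw [Set.inter_eq_iInter]
  exact isPolyhedron_iInter (by rintro (_ | _) <;> assumption)

lemma isPolyhedron_hyperplane (φ : V →ₗ[ℝ] ℝ) (β : ℝ) : IsPolyhedron {v | φ v = β} := by
  convert (isPolyhedron_halfspace φ β).inter (isPolyhedron_halfspace (-φ) (-β)) using 1
  ext v
  simp [le_antisymm_iff]

lemma IsPolyhedron.preimage {W : Type*} [AddCommGroup W] [Module ℝ W] {S : Set V}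
    (hS : IsPolyhedron S) (T : W →ₗ[ℝ] V) : IsPolyhedron (T ⁻¹' S) := by
  obtain ⟨k, φ, β, rfl⟩ := hS
  exact ⟨k, fun i => φ i ∘ₗ T, β, rfl⟩

lemma IsPolyhedron.isClosed {W : Type*} [NormedAddCommGroup W] [NormedSpace ℝ W]
    [FiniteDimensional ℝ W] {S : Set W} (hS : IsPolyhedron S) : IsClosed S := by
  obtain ⟨k, φ, β, rfl⟩ := hS
  rw [Set.ofPred_forall]
  exact isClosed_iInter fun i =>
    isClosed_le (LinearMap.continuous_of_finiteDimensional (φ i)) continuous_const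

lemma indicatorFun_ne_bot {E : Type*} (S : Set E) (x : E) : indicatorFun S x ≠ ⊥ := by
  unfold indicatorFun
  split_ifs <;> simp

lemma lowerSemicontinuous_indicatorFun {E : Type*} [TopologicalSpace E] {S : Set E}
    (hS : IsClosed S) : LowerSemicontinuous (indicatorFun S) := by
  intro x y hy
  by_cases hx : x ∈ S
  · refine Eventually.of_forall fun z => ?_
    simp only [indicatorFun, if_pos hx] at hy
    refine lt_of_lt_of_le hy ?_
    unfold indicatorFun
    split_ifs <;> simp
  · filter_upwards [hS.isOpen_compl.mem_nhds hx] with z hz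
    simp only [indicatorFun, if_neg hx] at hy
    simpa only [indicatorFun, if_neg (show z ∉ S from hz)] using hy

lemma IsPolyhedron.isPolyhedralFun_indicatorFun {S : Set V} (hS : IsPolyhedron S) :
    IsPolyhedralFun (indicatorFun S) := by
  have h := (hS.preimage (LinearMap.fst ℝ V ℝ)).inter
    (isPolyhedron_halfspace (-LinearMap.snd ℝ V ℝ) 0)
  rw [IsPolyhedralFun]
  convert h using 1
  ext ⟨x, s⟩
  change indicatorFun S x ≤ s ↔ x ∈ S ∧ -s ≤ 0
  unfold indicatorFun
  split_ifs with hx <;> simp [hx]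

lemma iInf_indicatorFun {E ι : Type*} (S : ι → Set E) (x : E) :
    ⨅ i, indicatorFun (S i) x = indicatorFun (⋃ i, S i) x := by
  by_cases hx : ∃ i, x ∈ S i
  · rw [indicatorFun, if_pos (Set.mem_iUnion.2 hx)]
    obtain ⟨i, hi⟩ := hx
    refine le_antisymm ((iInf_le _ i).trans_eq (if_pos hi)) (le_iInf fun j => ?_)
    unfold indicatorFun
    split_ifs <;> simp
  · rw [indicatorFun, if_neg (by simpa using hx), iInf_eq_top]
    exact fun i => if_neg fun hi => hx ⟨i, hi⟩

lemma indicatorFun_add_indicatorFun {E : Type*} (S T : Set E) (x : E) :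
    indicatorFun S x + indicatorFun T x = indicatorFun (S ∩ T) x := by
  by_cases hS : x ∈ S <;> by_cases hT : x ∈ T <;> simp [indicatorFun, hS, hT]

/-- The coordinate functionals of Euclidean space. -/
def coordLin (n : ℕ) (j : Fin n) : EuclideanSpace ℝ (Fin n) →ₗ[ℝ] ℝ :=
  (EuclideanSpace.proj j : EuclideanSpace ℝ (Fin n) →L[ℝ] ℝ).toLinearMap

@[simp]
lemma coordLin_apply (n : ℕ) (j : Fin n) (x : EuclideanSpace ℝ (Fin n)) : coordLin n j x = x j :=
  rfl

/-- The `ℓ1` norm is the maximum of the linear forms given by all sign patterns, encoded by the set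
`T` of positive signs. -/
lemma isPolyhedralFun_mul_sum_abs (n : ℕ) {μ : ℝ} (hμ : 0 < μ) :
    IsPolyhedralFun fun x : EuclideanSpace ℝ (Fin n) => ((μ * ∑ j, |x j| : ℝ) : EReal) := by
  classical
  let sgn : Finset (Fin n) → Fin n → ℝ := fun T j => if j ∈ T then μ else -μ
  let φ : Finset (Fin n) → (EuclideanSpace ℝ (Fin n) × ℝ) →ₗ[ℝ] ℝ := fun T =>
    (∑ j, sgn T j • coordLin n j) ∘ₗ
      LinearMap.fst ℝ _ _ - LinearMap.snd ℝ _ _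
  have hφ : ∀ T v, φ T v = ∑ j, sgn T j * v.1 j - v.2 := fun T v => by simp [φ]
  rw [IsPolyhedralFun]
  convert isPolyhedron_iInter_halfspace φ (fun _ => 0) using 1
  ext ⟨x, s⟩
  change ((μ * ∑ j, |x j| : ℝ) : EReal) ≤ s ↔ ∀ T, φ T (x, s) ≤ 0
  rw [EReal.coe_le_coe_iff, Finset.mul_sum]
  simp only [hφ, sub_nonpos]
  constructor
  · refine fun h T => le_trans (Finset.sum_le_sum fun j _ => ?_) h
    simp only [sgn]
    split_ifs
    · exact mul_le_mul_of_nonneg_left (le_abs_self _) hμ.le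
    · rw [neg_mul, ← mul_neg]
      exact mul_le_mul_of_nonneg_left (neg_le_abs _) hμ.le
  · intro h
    refine le_trans (Finset.sum_le_sum fun j _ => ?_) (h (Finset.univ.filter fun j => 0 ≤ x j))
    simp only [sgn, Finset.mem_filter, Finset.mem_univ, true_and]
    split_ifs with hj
    · rw [abs_of_nonneg hj]
    · rw [abs_of_neg (not_le.1 hj), mul_neg, neg_mul]

end PolyhedralFunctions

/-! ### The models -/

section Models

lemma isPolyhedron_unitSimplex (n : ℕ) : IsPolyhedron (unitSimplex n) := by
  convert (isPolyhedron_hyperplane (∑ j, coordLin n j) 1).inter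
    (isPolyhedron_iInter_halfspace (fun j => -coordLin n j) (fun _ => 0)) using 1
  ext x
  simp [unitSimplex]

/-- The vectors supported in `T`. -/
def supportedIn (n : ℕ) (T : Finset (Fin n)) : Set (EuclideanSpace ℝ (Fin n)) :=
  {x | ∀ j, j ∉ T → x j = 0}

lemma isPolyhedron_supportedIn (n : ℕ) (T : Finset (Fin n)) : IsPolyhedron (supportedIn n T) := by
  convert isPolyhedron_iInter (ι := {j : Fin n // j ∉ T}) fun j => isPolyhedron_hyperplane
    (coordLin n j.1) 0 using 1
  ext x
  simp [supportedIn]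

lemma sparseSet_eq_iUnion (n s : ℕ) :
    sparseSet n s = ⋃ T : {T : Finset (Fin n) // T.card ≤ s}, supportedIn n T := by
  classical
  ext x
  rw [Set.mem_iUnion]
  constructor
  · intro (hx : {i | x i ≠ 0}.ncard ≤ s)
    refine ⟨⟨Finset.univ.filter fun i => x i ≠ 0, ?_⟩, fun j hj => by simpa using hj⟩
    rw [← Set.ncard_coe_finset]
    simpa using hx
  · rintro ⟨⟨T, hT⟩, hx⟩
    change {i | x i ≠ 0}.ncard ≤ s
    refine le_trans ?_ hT
    rw [← Set.ncard_coe_finset]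
    refine Set.ncard_le_ncard (fun i (hi : x i ≠ 0) => ?_) T.finite_toSet
    by_contra h
    exact hi (hx i h)

/-- An admissible loss restricted to a finite union of polyhedra. -/
lemma IsAdmissibleLoss.isKLFunctionWithExponent_add_indicatorFun {m n : ℕ} {ι : Type*} [Finite ι]
    {l : EuclideanSpace ℝ (Fin m) → EReal} (hl : IsAdmissibleLoss l)
    (A : EuclideanSpace ℝ (Fin n) →ₗ[ℝ] EuclideanSpace ℝ (Fin m))
    {S : ι → Set (EuclideanSpace ℝ (Fin n))} (hS : ∀ i, IsPolyhedron (S i))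
    (hprop : IsProper fun x => l (A x) + indicatorFun (⋃ i, S i) x) :
    IsKLFunctionWithExponent (fun x => l (A x) + indicatorFun (⋃ i, S i) x) (1 / 2) :=
  hl.isKLFunctionWithExponent A (fun i => indicatorFun_ne_bot (S i))
    (fun i => lowerSemicontinuous_indicatorFun (hS i).isClosed)
    (fun i => (hS i).isPolyhedralFun_indicatorFun)
    (fun x => by rw [iInf_indicatorFun]) hprop

end Models

end KLExponent

end

theorem mainTheorem3 (m n : ℕ) (A : Matrix (Fin m) (Fin n) ℝ) :
    -- the general result
    (∀ l : EuclideanSpace ℝ (Fin m) → EReal,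
      (IsLocallyStronglyConvexLoss l ∨ IsPolyhedralConjugateLoss l) →
      ∀ (r : ℕ) (P : Fin r → EuclideanSpace ℝ (Fin n) → EReal),
      (∀ i, IsProper (P i) ∧ LowerSemicontinuous (P i) ∧ IsPolyhedralFun (P i)) →
      ∀ f : EuclideanSpace ℝ (Fin n) → EReal,
      (∀ x, f x = l (A.toEuclideanLin x) + ⨅ i, P i x) →
      IsProper f → LowerSemicontinuous f → ContinuousOn f (domSubdiff f) →
      IsKLFunctionWithExponent f (1 / 2)) ∧
    -- both standard losses belong to the first class
    (∀ b : Fin m → ℝ, (∀ i, b i ≠ 0) → IsLocallyStronglyConvexLoss (logisticLoss b)) ∧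
    (∀ b : EuclideanSpace ℝ (Fin m), IsLocallyStronglyConvexLoss (leastSquaresLoss b)) ∧
    -- `ℓ1`-regularized logistic regression
    (∀ (b : Fin m → ℝ) (μ : ℝ), (∀ i, b i ≠ 0) → 0 < μ →
      IsKLFunctionWithExponent
        (fun x : EuclideanSpace ℝ (Fin n) =>
          logisticLoss b (A.toEuclideanLin x) + ((μ * ∑ j, |x j| : ℝ) : EReal)) (1 / 2)) ∧
    -- the cardinality-constrained model and the sparse index tracking model
    (∀ l : EuclideanSpace ℝ (Fin m) → EReal,
      (IsLocallyStronglyConvexLoss l ∨ IsPolyhedralConjugateLoss l) →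
      ∀ s : ℕ, 0 < s →
      (IsProper (fun x : EuclideanSpace ℝ (Fin n) =>
          l (A.toEuclideanLin x) + indicatorFun (sparseSet n s) x) →
        IsKLFunctionWithExponent (fun x : EuclideanSpace ℝ (Fin n) =>
          l (A.toEuclideanLin x) + indicatorFun (sparseSet n s) x) (1 / 2)) ∧
      (IsProper (fun x : EuclideanSpace ℝ (Fin n) =>
          l (A.toEuclideanLin x) + indicatorFun (sparseSet n s) x
            + indicatorFun (unitSimplex n) x) →
        IsKLFunctionWithExponent (fun x : EuclideanSpace ℝ (Fin n) =>
          l (A.toEuclideanLin x) + indicatorFun (sparseSet n s) x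
            + indicatorFun (unitSimplex n) x) (1 / 2))) := by
  refine ⟨fun l hl r P hP f hf hprop _ _ => ?_,
    fun b hb => isLocallyStronglyConvexLoss_logisticLoss hb,
    isLocallyStronglyConvexLoss_leastSquaresLoss, fun b μ hb hμ => ?_, fun l hl s _ => ⟨?_, ?_⟩⟩
  · exact (isAdmissibleLoss_of_or hl).isKLFunctionWithExponent _ (fun i => (hP i).1.1)
      (fun i => (hP i).2.1) (fun i => (hP i).2.2) hf hprop
  · refine (isLocallyStronglyConvexLoss_logisticLoss hb).isAdmissibleLoss.isKLFunctionWithExponent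
      A.toEuclideanLin
      (P := fun (_ : Unit) (x : EuclideanSpace ℝ (Fin n)) => ((μ * ∑ j, |x j| : ℝ) : EReal))
      (fun _ x => EReal.coe_ne_bot _) (fun _ => ?_) (fun _ => isPolyhedralFun_mul_sum_abs n hμ)
      (fun x => by rw [ciInf_const]) ⟨fun x => ?_, 0, ?_⟩
    · exact (continuous_coe_real_ereal.comp (by fun_prop)).lowerSemicontinuous
    · exact EReal.add_ne_bot_iff.2 ⟨EReal.coe_ne_bot _, EReal.coe_ne_bot _⟩
    · exact EReal.add_lt_top (EReal.coe_ne_top _) (EReal.coe_ne_top _)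
  · rw [sparseSet_eq_iUnion]
    exact (isAdmissibleLoss_of_or hl).isKLFunctionWithExponent_add_indicatorFun _
      fun T => isPolyhedron_supportedIn n T
  -- Intersecting with the simplex distributes over the union of coordinate subspaces, leaving a
  -- finite union of polyhedra.
  · simp only [add_assoc, indicatorFun_add_indicatorFun]
    rw [sparseSet_eq_iUnion, Set.iUnion_inter]
    exact (isAdmissibleLoss_of_or hl).isKLFunctionWithExponent_add_indicatorFun _
      fun T => (isPolyhedron_supportedIn n T).inter (isPolyhedron_unitSimplex n)
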